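/- Let $\mathbb D=\{z\in\mathbb C:|z|<1\}$ and let $dA$ be the normalized Lebesgue (area) measure on $\mathbb D$. For $\alpha\in\mathbb R$ and $f$ analytic in $\mathbb D$ put $$\|f\|_{\mathfrak B^1_{\log^\alpha}}=|f(0)|+\int_{\mathbb D}|f'(z)|\,\log^\alpha\frac{2}{1-|z|}\,dA(z)\in[0,\infty],$$ and let $\mathfrak B^1_{\log^\alpha}$ be the space of all $f$ analytic in $\mathbb D$ with $\|f\|_{\mathfrak B^1_{\log^\alpha}}<\infty$. Theorem. Let $\alpha\ge-1$. There is a constant $C>0$, depending only on $\alpha$, such that for every nonincreasing sequence $(a_n)_{n\ge0}$ of real numbers tending to $0$, with $f(z)=\sum_{n=0}^\infty a_nz^n$ $(z\in\mathbb D)$, the following holds. The function $f$ belongs to $\mathfrak B^1_{\log^\alpha}$ if and only if $$S_\alpha(f):=\sum_{n=0}^\infty\frac{a_n\log^\alpha(n+2)}{n+1}<\infty.$$ Moreover, $$\frac{S_\alpha(f)}{C}\le\|f\|_{\mathfrak B^1_{\log^\alpha}}\le C\,S_\alpha(f)$$ (as an inequality in $[0,\infty]$; both sides are infinite when $f\notin\mathfrak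 B^1_{\log^\alpha}$). -/

import Mathlib

open Filter Topology MeasureTheory
open scoped NNReal ENNReal

/-- The normalized area measure `dA` on the open unit disk of the complex plane
(total mass `1`). -/
noncomputable def diskArea : Measure ℂ :=
  (ENNReal.ofReal Real.pi)⁻¹ • (volume : Measure ℂ).restrict (Metric.ball (0 : ℂ) 1)

/-- The norm `|f(0)| + ∫_𝔻 |f'(z)| log^α (2 / (1 - |z|)) dA(z)`, with values in `[0, ∞]`. -/
noncomputable def blochOneLogNorm (α : ℝ) (f : ℂ → ℂ) : ℝ≥0∞ :=
  ENNReal.ofReal ‖f 0‖ +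
    ∫⁻ z, ENNReal.ofReal (‖deriv f z‖ * Real.log (2 / (1 - ‖z‖)) ^ α) ∂diskArea

/-- The space `𝔅¹_{log^α}`: the functions analytic in the open unit disk for which
`blochOneLogNorm` is finite. A function on the disk is represented by any extension of it
to `ℂ`; only its values on the open disk matter. -/
def blochOneLog (α : ℝ) : Set (ℂ → ℂ) :=
  {f | DifferentiableOn ℂ f (Metric.ball 0 1) ∧ blochOneLogNorm α f < ∞}

/-- The `n`-th term `a_n log^α (n + 2) / (n + 1)` of the series `S_α`. -/
noncomputable def logTerm (α : ℝ) (a : ℕ → ℝ) (n : ℕ) : ℝ :=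
  a n * Real.log ((n : ℝ) + 2) ^ α / ((n : ℝ) + 1)

/-- The sum `S_α = ∑ a_n log^α (n + 2) / (n + 1)` in `[0, ∞]`, for nonnegative `a_n`
(a nonincreasing sequence with limit `0` is nonnegative). -/
noncomputable def logSum (α : ℝ) (a : ℕ → ℝ) : ℝ≥0∞ :=
  ∑' n, ENNReal.ofReal (logTerm α a n)

/-! Upper bound. Abel summation writes `f'` as the sum of `(a k - a (k + 1)) * geomDeriv k`, a
combination with nonnegative coefficients, so it suffices to bound the weighted area integral of
each `geomDeriv k`. `lintegral_geomDeriv_le` bounds it by a constant times the partial sum of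
`logWeight α n` over `n ≤ k`; interchanging the sums (`tsum_ofReal_sub_mul_sum_eq`) turns these
partial sums back into `logSum α a`. For a single kernel the disk is split at `r = 1 - 1/k`. Outside
that radius the crude size of the kernel is enough; inside it the kernel is about `1/|1-z|^2 + k
r^k/|1-z|`. Integrating over angle and radius leaves the partial sum itself and a multiple of
`log^(α+1) (2k)`. The latter is absorbed by `log_rpow_add_one_le_sum`; the monotonicity of `x ^ (α +
1)` used on the way is where `α ≥ -1` enters.

Lower bound. Integration by parts on the circle of radius `r` gives `2 |f r - f 0| ≤ r ∫ |f'|`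
(`two_mul_norm_sub_le_integral`). As `a n ≥ 0`, the left side controls the sum of `a (n+1) r^(n+1)`.
Integrating against `log^α (2/(1-r)) dr` term by term, each power contributes at least a multiple of
its weight (`logWeight_le_setLIntegral`). The term `n = 0` comes from `|f 0|`. -/

/-! ### Pointwise bounds for the kernels `geomDeriv k`. -/

/-- The derivative of `1 + z + ⋯ + z ^ k`. -/
noncomputable def geomDeriv (k : ℕ) (z : ℂ) : ℂ :=
  ∑ j ∈ Finset.range k, ((j : ℂ) + 1) * z ^ j

lemma continuous_geomDeriv (k : ℕ) : Continuous (geomDeriv k) := by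
  unfold geomDeriv; fun_prop

lemma one_sub_mul_geomDeriv (k : ℕ) (z : ℂ) :
    (1 - z) * geomDeriv k z = ∑ j ∈ Finset.range k, z ^ j - k * z ^ k := by
  unfold geomDeriv
  induction k with
  | zero => simp
  | succ k ih =>
    rw [Finset.sum_range_succ, Finset.sum_range_succ, mul_add, ih]
    push_cast; ring

lemma norm_geomDeriv_le (k : ℕ) {z : ℂ} (hz : ‖z‖ ≤ 1) : ‖geomDeriv k z‖ ≤ (k : ℝ) ^ 2 := by
  refine (norm_sum_le _ _).trans ?_
  refine (Finset.sum_le_card_nsmul _ _ (k : ℝ) ?_).trans ?_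
  · intro j hj
    have hj' : (j : ℝ) + 1 ≤ k := by exact_mod_cast Finset.mem_range.1 hj
    rw [norm_mul, norm_pow]
    have h1 : ‖(j : ℂ) + 1‖ = (j : ℝ) + 1 := by
      rw [show (j : ℂ) + 1 = ((j + 1 : ℕ) : ℂ) by push_cast; rfl, Complex.norm_natCast]
      push_cast; rfl
    rw [h1]
    calc ((j : ℝ) + 1) * ‖z‖ ^ j ≤ ((j : ℝ) + 1) * 1 := by
          gcongr; exact pow_le_one₀ (norm_nonneg _) hz
      _ ≤ k := by linarith
  · simp [sq]

lemma norm_geomDeriv_mul_le (k : ℕ) {z : ℂ} (hz : ‖z‖ ≤ 1) :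
    ‖geomDeriv k z‖ * ‖1 - z‖ ≤ 2 * k := by
  rw [mul_comm, ← norm_mul, one_sub_mul_geomDeriv]
  refine (norm_sub_le _ _).trans ?_
  have h1 : ‖∑ j ∈ Finset.range k, z ^ j‖ ≤ k := by
    refine (norm_sum_le _ _).trans ((Finset.sum_le_card_nsmul _ _ (1 : ℝ) ?_).trans (by simp))
    intro j _
    rw [norm_pow]; exact pow_le_one₀ (norm_nonneg _) hz
  have h2 : ‖(k : ℂ) * z ^ k‖ ≤ k := by
    rw [norm_mul, norm_pow, Complex.norm_natCast]
    exact mul_le_of_le_one_right (by positivity) (pow_le_one₀ (norm_nonneg _) hz)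
  linarith

/-- The factor `‖z‖ ^ k` is kept on purpose: `k * r ^ k` has integral at most `1` over `(0, 1)`,
whereas `k` alone would be too large away from the unit circle. -/
lemma norm_geomDeriv_mul_sq_le (k : ℕ) {z : ℂ} (hz : ‖z‖ ≤ 1) :
    ‖geomDeriv k z‖ * ‖1 - z‖ ^ 2 ≤ 2 + k * ‖z‖ ^ k * ‖1 - z‖ := by
  have h : (1 - z) ^ 2 * geomDeriv k z = (1 - z ^ k) - k * z ^ k * (1 - z) := by
    have := one_sub_mul_geomDeriv k z
    have h2 := mul_neg_geom_sum z k
    linear_combination (1 - z) * this + h2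
  rw [mul_comm, ← norm_pow, ← norm_mul, h]
  refine (norm_sub_le _ _).trans ?_
  have h1 : ‖1 - z ^ k‖ ≤ 2 := by
    refine (norm_sub_le _ _).trans ?_
    rw [norm_pow, norm_one]
    linarith [pow_le_one₀ (norm_nonneg z) hz (n := k)]
  have h2 : ‖(k : ℂ) * z ^ k * (1 - z)‖ = k * ‖z‖ ^ k * ‖1 - z‖ := by
    rw [norm_mul, norm_mul, norm_pow, Complex.norm_natCast]
  linarith

/-- Moving `r e^{iθ}` radially to `e^{iθ}` costs `1 - r`, itself at most the distance to `1`; so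
that distance is at least half of `|1 - e^{iθ}| = 2 |sin (θ/2)|`, and Jordan's inequality applies.
-/
lemma abs_div_pi_le_norm_one_sub {r θ : ℝ} (hr0 : 0 ≤ r) (hr : r ≤ 1) (hθ : |θ| ≤ Real.pi) :
    |θ| / Real.pi ≤ ‖1 - (r : ℂ) * Complex.exp (θ * Complex.I)‖ := by
  set e := Complex.exp (θ * Complex.I) with he
  have hne : ‖e‖ = 1 := Complex.norm_exp_ofReal_mul_I θ
  have h1 : 1 - r ≤ ‖1 - (r : ℂ) * e‖ := by
    have := norm_sub_norm_le (1 : ℂ) (r * e)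
    rw [norm_mul, hne, Complex.norm_real, norm_one, Real.norm_of_nonneg hr0] at this
    linarith
  have h2 : ‖1 - e‖ ≤ ‖1 - (r : ℂ) * e‖ + (1 - r) := by
    have h3 : ‖((r : ℂ) - 1) * e‖ = 1 - r := by
      rw [norm_mul, hne, mul_one, show (r : ℂ) - 1 = ((r - 1 : ℝ) : ℂ) by push_cast; rfl,
        Complex.norm_real, Real.norm_of_nonpos (by linarith)]
      ring
    rw [← h3]
    refine le_trans (le_of_eq ?_) (norm_add_le _ _)
    congr 1; ring
  have h3 : 2 * (|θ| / Real.pi) ≤ ‖1 - e‖ := by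
    have h4 : ‖1 - e‖ = 2 * |Real.sin (θ / 2)| := by
      rw [norm_sub_rev]
      have := Complex.norm_exp_I_mul_ofReal_sub_one θ
      rw [mul_comm Complex.I] at this
      rw [this, norm_mul]
      simp
    have h5 := Real.mul_abs_le_abs_sin (x := θ / 2) (by rw [abs_div, abs_two]; linarith)
    rw [abs_div, abs_two] at h5
    rw [h4]
    calc 2 * (|θ| / Real.pi) = 2 * (2 / Real.pi * (|θ| / 2)) := by ring
      _ ≤ _ := by linarith
  linarith

lemma add_abs_le_norm_one_sub {r θ : ℝ} (hr0 : 0 ≤ r) (hr : r ≤ 1) (hθ : |θ| ≤ Real.pi) :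
    1 - r + |θ| ≤ 5 * ‖1 - (r : ℂ) * Complex.exp (θ * Complex.I)‖ := by
  have h1 := abs_div_pi_le_norm_one_sub hr0 hr hθ
  have h2 : 1 - r ≤ ‖1 - (r : ℂ) * Complex.exp (θ * Complex.I)‖ := by
    have := norm_sub_norm_le (1 : ℂ) (r * Complex.exp (θ * Complex.I))
    rw [norm_mul, Complex.norm_exp_ofReal_mul_I, Complex.norm_real, norm_one,
      Real.norm_of_nonneg hr0] at this
    linarith
  rw [div_le_iff₀ Real.pi_pos] at h1
  have := Real.pi_le_four
  nlinarith [norm_nonneg (1 - (r : ℂ) * Complex.exp (θ * Complex.I))]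

lemma norm_geomDeriv_le_of_outer (k : ℕ) {r θ : ℝ} (hr0 : 0 ≤ r) (hr : r < 1)
    (hθ : |θ| ≤ Real.pi) :
    ‖geomDeriv k (r * Complex.exp (θ * Complex.I))‖ ≤
      50 * (1 / (1 - r + |θ|) ^ 2) + 5 * k * r ^ k * (1 / (1 - r + |θ|)) := by
  set z := (r : ℂ) * Complex.exp (θ * Complex.I) with hz
  have hzn : ‖z‖ = r := by
    rw [hz, norm_mul, Complex.norm_exp_ofReal_mul_I, Complex.norm_real,
      Real.norm_of_nonneg hr0, mul_one]
  have h1 := add_abs_le_norm_one_sub hr0 hr.le hθ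
  have h2 := norm_geomDeriv_mul_sq_le k (z := z) (by rw [hzn]; exact hr.le)
  rw [hzn] at h2
  have hp : 0 < 1 - r + |θ| := by have := abs_nonneg θ; linarith
  have hd : 0 < ‖1 - z‖ := by rw [← hz] at h1; linarith
  have h3 : ‖geomDeriv k z‖ ≤ 2 * (1 / ‖1 - z‖) ^ 2 + k * r ^ k * (1 / ‖1 - z‖) := by
    have : 2 * (1 / ‖1 - z‖) ^ 2 + k * r ^ k * (1 / ‖1 - z‖)
        = (2 + k * r ^ k * ‖1 - z‖) / ‖1 - z‖ ^ 2 := by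
      field_simp
    rw [this, le_div_iff₀ (by positivity)]
    exact h2
  have h4 : 1 / ‖1 - z‖ ≤ 5 * (1 / (1 - r + |θ|)) := by
    rw [mul_one_div, div_le_div_iff₀ hd hp]; linarith
  calc _ ≤ _ := h3
    _ ≤ 2 * (5 * (1 / (1 - r + |θ|))) ^ 2 + k * r ^ k * (5 * (1 / (1 - r + |θ|))) := by gcongr
    _ = _ := by generalize 1 - r + |θ| = x; ring

lemma norm_geomDeriv_le_of_inner {k : ℕ} (hk : 1 ≤ k) {r θ : ℝ} (hr0 : 0 ≤ r) (hr : r ≤ 1)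
    (hθ : |θ| ≤ Real.pi) :
    ‖geomDeriv k (r * Complex.exp (θ * Complex.I))‖ ≤ 12 * k * (1 / (1 / k + |θ|)) := by
  set z := (r : ℂ) * Complex.exp (θ * Complex.I) with hz
  have hzn : ‖z‖ ≤ 1 := by
    rw [hz, norm_mul, Complex.norm_exp_ofReal_mul_I, Complex.norm_real,
      Real.norm_of_nonneg hr0, mul_one]; exact hr
  have h1 := abs_div_pi_le_norm_one_sub hr0 hr hθ
  rw [← hz, div_le_iff₀ Real.pi_pos] at h1
  have h2 := norm_geomDeriv_mul_le k hzn
  have h3 := norm_geomDeriv_le k hzn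
  have hk0 : (0 : ℝ) < k := by exact_mod_cast hk
  -- The bound `k ^ 2` handles the summand `1 / k` and the bound `2k / |1 - z|` handles `|θ|`, for a
  -- total of `9k`.
  have h4 : ‖geomDeriv k z‖ * (1 / k) ≤ k := by
    rw [mul_one_div, div_le_iff₀ hk0]; linarith
  rw [mul_one_div, le_div_iff₀ (by positivity)]
  have h5 : |θ| ≤ 4 * ‖1 - z‖ := h1.trans (by nlinarith [Real.pi_le_four, norm_nonneg (1 - z)])
  have h6 := mul_le_mul_of_nonneg_left h5 (norm_nonneg (geomDeriv k z))
  linarith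

/-! ### Polar coordinates and integrals over the angle. -/

lemma lintegral_diskArea_eq_polar {h : ℂ → ℂ} {φ : ℝ → ℝ} (hh : Measurable h)
    (hφ : Measurable φ) :
    ∫⁻ z, ENNReal.ofReal (‖h z‖ * φ ‖z‖) ∂diskArea =
      (ENNReal.ofReal Real.pi)⁻¹ * ∫⁻ r in Set.Ioo (0 : ℝ) 1,
        ENNReal.ofReal r * ENNReal.ofReal (φ r) *
          ∫⁻ θ in Set.Ioo (-Real.pi) Real.pi, ENNReal.ofReal ‖h (circleMap 0 r θ)‖ := by
  rw [diskArea, lintegral_smul_measure, smul_eq_mul]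
  congr 1
  rw [← lintegral_indicator Metric.isOpen_ball.measurableSet,
    ← Complex.lintegral_comp_polarCoord_symm, polarCoord_target, Measure.volume_eq_prod,
    ← Measure.prod_restrict, lintegral_prod]
  · rw [show Set.Ioo (0 : ℝ) 1 = Set.Iio 1 ∩ Set.Ioi 0 by ext; simp [and_comm],
      ← setLIntegral_indicator measurableSet_Iio]
    refine setLIntegral_congr_fun measurableSet_Ioi fun r hr => ?_
    have hr0 : (0 : ℝ) < r := hr
    have hc : ∀ θ : ℝ, Complex.polarCoord.symm (r, θ) = circleMap 0 r θ := fun θ => by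
      rw [Complex.polarCoord_symm_apply, circleMap_zero, Complex.exp_mul_I]; simp
    have hn : ∀ θ : ℝ, ‖circleMap 0 r θ‖ = r := fun θ => by simp [abs_of_pos hr0]
    by_cases h1 : r < 1
    · have hm : Measurable fun θ : ℝ => ENNReal.ofReal ‖h (circleMap 0 r θ)‖ :=
        (hh.comp (continuous_circleMap 0 r).measurable).norm.ennreal_ofReal
      rw [Set.indicator_of_mem (show r ∈ Set.Iio 1 from h1), ← lintegral_const_mul _ hm]
      refine lintegral_congr fun θ => ?_
      rw [hc, Set.indicator_of_mem (by simpa [hn] using h1), hn,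
        ENNReal.ofReal_mul (norm_nonneg _), smul_eq_mul]
      ring
    · rw [Set.indicator_of_notMem (show r ∉ Set.Iio 1 from h1)]
      rw [← lintegral_zero (μ := volume.restrict (Set.Ioo (-Real.pi) Real.pi))]
      refine lintegral_congr fun θ => ?_
      rw [hc, Set.indicator_of_notMem (by simpa [hn] using h1), smul_zero]
  · refine Measurable.aemeasurable ?_
    have hm : Measurable fun p : ℝ × ℝ => Complex.polarCoord.symm p := by
      simp only [Complex.polarCoord_symm_apply]; fun_prop
    have hg : Measurable fun z : ℂ => ENNReal.ofReal (‖h z‖ * φ ‖z‖) := by fun_prop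
    exact (ENNReal.measurable_ofReal.comp measurable_fst).mul
      ((hg.indicator Metric.isOpen_ball.measurableSet).comp hm)

/-- Covering the interval by its two halves and `{0}` needs only subadditivity, hence no
measurability of `g`. -/
lemma setLIntegral_abs_le (g : ℝ → ℝ≥0∞) :
    ∫⁻ θ in Set.Ioo (-Real.pi) Real.pi, g |θ| ≤ 2 * ∫⁻ θ in Set.Ioo 0 Real.pi, g θ := by
  have hsub : Set.Ioo (-Real.pi) Real.pi ⊆
      (Set.Ioo 0 Real.pi ∪ (fun x : ℝ => -x) ⁻¹' Set.Ioo 0 Real.pi) ∪ {0} := by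
    intro x hx
    rcases lt_trichotomy x 0 with h | h | h
    · left; right; exact ⟨by simpa using h, by linarith [hx.1]⟩
    · right; exact h
    · left; left; exact ⟨h, hx.2⟩
  have h1 : ∫⁻ θ in Set.Ioo 0 Real.pi, g |θ| = ∫⁻ θ in Set.Ioo 0 Real.pi, g θ :=
    setLIntegral_congr_fun measurableSet_Ioo fun x hx => by rw [abs_of_pos hx.1]
  have h2 : ∫⁻ θ in (fun x : ℝ => -x) ⁻¹' Set.Ioo 0 Real.pi, g |θ|
      = ∫⁻ θ in Set.Ioo 0 Real.pi, g |θ| := by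
    rw [← (Measure.measurePreserving_neg (volume : Measure ℝ)).setLIntegral_comp_preimage_emb
      (MeasurableEquiv.neg ℝ).measurableEmbedding (fun x => g |x|)]
    simp
  calc _ ≤ _ := lintegral_mono_set hsub
    _ ≤ _ := lintegral_union_le (fun θ => g |θ|) _ _
    _ ≤ ((∫⁻ θ in Set.Ioo 0 Real.pi, g |θ|) + ∫⁻ θ in (fun x : ℝ => -x) ⁻¹' Set.Ioo 0 Real.pi, g |θ|)
        + 0 := by
      refine add_le_add ?_ ?_
      · exact lintegral_union_le (fun θ => g |θ|) _ _
      · exact (setLIntegral_measure_zero _ _ (by simp)).le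
    _ = _ := by rw [h2, h1]; ring

lemma setLIntegral_Ioo_ofReal_eq {a b : ℝ} (hab : a ≤ b) {g : ℝ → ℝ}
    (hg : IntervalIntegrable g volume a b) (h0 : ∀ x ∈ Set.Ioo a b, 0 ≤ g x) :
    ∫⁻ x in Set.Ioo a b, ENNReal.ofReal (g x) = ENNReal.ofReal (∫ x in a..b, g x) := by
  rw [intervalIntegral.integral_of_le hab, integral_Ioc_eq_integral_Ioo,
    ofReal_integral_eq_lintegral_ofReal]
  · exact ((intervalIntegrable_iff_integrableOn_Ioo_of_le hab).1 hg)
  · exact (ae_restrict_iff' measurableSet_Ioo).2 (ae_of_all _ h0)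

lemma integral_one_div_add {s b : ℝ} (hs : 0 < s) (hb : 0 ≤ b) :
    IntervalIntegrable (fun x => 1 / (s + x)) volume 0 b ∧
      ∫ x in (0 : ℝ)..b, 1 / (s + x) = Real.log ((s + b) / s) := by
  have hi : IntervalIntegrable (fun x => 1 / (s + x)) volume 0 b := by
    apply ContinuousOn.intervalIntegrable
    apply ContinuousOn.div (by fun_prop) (by fun_prop)
    intro x hx
    rw [Set.uIcc_of_le hb] at hx
    linarith [hx.1]
  refine ⟨hi, ?_⟩
  rw [intervalIntegral.integral_eq_sub_of_hasDerivAt (f := fun x => Real.log (s + x)) _ hi]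
  · rw [Real.log_div (by positivity) hs.ne', add_zero]
  · intro x hx
    rw [Set.uIcc_of_le hb] at hx
    exact ((hasDerivAt_id x).const_add s).log (by have := hx.1; simp only [id]; positivity)

lemma integral_one_div_add_sq_le {s b : ℝ} (hs : 0 < s) (hb : 0 ≤ b) :
    IntervalIntegrable (fun x => 1 / (s + x) ^ 2) volume 0 b ∧
      ∫ x in (0 : ℝ)..b, 1 / (s + x) ^ 2 ≤ 1 / s := by
  have hi : IntervalIntegrable (fun x => 1 / (s + x) ^ 2) volume 0 b := by
    apply ContinuousOn.intervalIntegrable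
    apply ContinuousOn.div (by fun_prop) (by fun_prop)
    intro x hx
    rw [Set.uIcc_of_le hb] at hx
    have := hx.1
    positivity
  refine ⟨hi, ?_⟩
  rw [intervalIntegral.integral_eq_sub_of_hasDerivAt (f := fun x => -(s + x)⁻¹) _ hi]
  · have : 0 ≤ (s + b)⁻¹ := by positivity
    simp only [add_zero, one_div]; linarith
  · intro x hx
    rw [Set.uIcc_of_le hb] at hx
    have := hx.1
    have h := (((hasDerivAt_id x).const_add s).inv (by simp only [id]; positivity)).neg
    simp only [id] at h
    rw [show 1 / (s + x) ^ 2 = -(-1 / (s + x) ^ 2) by ring]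
    exact h

lemma log_add_pi_div_le {s : ℝ} (hs : 0 < s) (hs1 : s ≤ 1) :
    Real.log ((s + Real.pi) / s) ≤ 3 * Real.log (2 / s) := by
  -- The claim becomes `(s + π) s^2 ≤ 8`, clear from `s ≤ 1` and `π ≤ 4`.
  rw [← Real.log_rpow (by positivity), show (3 : ℝ) = ((3 : ℕ) : ℝ) by norm_num, Real.rpow_natCast]
  apply Real.log_le_log (by positivity)
  rw [div_pow, div_le_div_iff₀ hs (by positivity)]
  have := Real.pi_le_four
  have h2 : s ^ 2 ≤ 1 := pow_le_one₀ hs.le hs1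
  nlinarith [mul_nonneg hs.le (sub_nonneg.2 h2), mul_pos hs hs, Real.pi_pos]

lemma setLIntegral_one_div_add_abs_le {s : ℝ} (hs : 0 < s) (hs1 : s ≤ 1) :
    ∫⁻ θ in Set.Ioo (-Real.pi) Real.pi, ENNReal.ofReal (1 / (s + |θ|)) ≤
      ENNReal.ofReal (6 * Real.log (2 / s)) := by
  refine (setLIntegral_abs_le fun θ => ENNReal.ofReal (1 / (s + θ))).trans ?_
  obtain ⟨h1, h2⟩ := integral_one_div_add hs Real.pi_pos.le
  rw [setLIntegral_Ioo_ofReal_eq Real.pi_pos.le h1, h2, ← ENNReal.ofReal_ofNat 2,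
    ← ENNReal.ofReal_mul (by norm_num)]
  · apply ENNReal.ofReal_le_ofReal; linarith [log_add_pi_div_le hs hs1]
  · intro x hx; have := hx.1; positivity

lemma setLIntegral_one_div_add_abs_sq_le {s : ℝ} (hs : 0 < s) :
    ∫⁻ θ in Set.Ioo (-Real.pi) Real.pi, ENNReal.ofReal (1 / (s + |θ|) ^ 2) ≤
      ENNReal.ofReal (2 * (1 / s)) := by
  refine (setLIntegral_abs_le fun θ => ENNReal.ofReal (1 / (s + θ) ^ 2)).trans ?_
  obtain ⟨h1, h2⟩ := integral_one_div_add_sq_le hs Real.pi_pos.le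
  rw [setLIntegral_Ioo_ofReal_eq Real.pi_pos.le h1, ← ENNReal.ofReal_ofNat 2,
    ← ENNReal.ofReal_mul (by norm_num)]
  · apply ENNReal.ofReal_le_ofReal; linarith
  · intro x hx; positivity

lemma setLIntegral_geomDeriv_le_of_outer (k : ℕ) {r : ℝ} (hr0 : 0 ≤ r) (hr : r < 1) :
    ∫⁻ θ in Set.Ioo (-Real.pi) Real.pi, ENNReal.ofReal ‖geomDeriv k (circleMap 0 r θ)‖ ≤
      ENNReal.ofReal (100 * (1 / (1 - r)) + 30 * k * r ^ k * Real.log (2 / (1 - r))) := by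
  have hs : 0 < 1 - r := by linarith
  have hL : 0 ≤ Real.log (2 / (1 - r)) :=
    Real.log_nonneg (by rw [le_div_iff₀ hs]; linarith)
  calc _ ≤ ∫⁻ θ in Set.Ioo (-Real.pi) Real.pi,
        (ENNReal.ofReal 50 * ENNReal.ofReal (1 / (1 - r + |θ|) ^ 2) +
          ENNReal.ofReal (5 * k * r ^ k) * ENNReal.ofReal (1 / (1 - r + |θ|))) := by
        refine setLIntegral_mono' measurableSet_Ioo fun θ hθ => ?_
        rw [← ENNReal.ofReal_mul (by norm_num), ← ENNReal.ofReal_mul (by positivity),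
          ← ENNReal.ofReal_add (by positivity) (by positivity), circleMap_zero]
        exact ENNReal.ofReal_le_ofReal
          (norm_geomDeriv_le_of_outer k hr0 hr (abs_le.2 ⟨hθ.1.le, hθ.2.le⟩))
    _ = ENNReal.ofReal 50 * (∫⁻ θ in Set.Ioo (-Real.pi) Real.pi,
          ENNReal.ofReal (1 / (1 - r + |θ|) ^ 2)) + ENNReal.ofReal (5 * k * r ^ k) *
        ∫⁻ θ in Set.Ioo (-Real.pi) Real.pi, ENNReal.ofReal (1 / (1 - r + |θ|)) := by
        rw [lintegral_add_left (by fun_prop), lintegral_const_mul _ (by fun_prop),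
          lintegral_const_mul _ (by fun_prop)]
    _ ≤ ENNReal.ofReal 50 * ENNReal.ofReal (2 * (1 / (1 - r))) + ENNReal.ofReal (5 * k * r ^ k) *
        ENNReal.ofReal (6 * Real.log (2 / (1 - r))) := by
        gcongr
        · exact setLIntegral_one_div_add_abs_sq_le hs
        · exact setLIntegral_one_div_add_abs_le hs (by linarith)
    _ = _ := by
        rw [← ENNReal.ofReal_mul (by norm_num), ← ENNReal.ofReal_mul (by positivity),
          ← ENNReal.ofReal_add (by positivity) (by positivity)]
        congr 1; ring

lemma setLIntegral_geomDeriv_le_of_inner {k : ℕ} (hk : 1 ≤ k) {r : ℝ} (hr0 : 0 ≤ r)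
    (hr : r ≤ 1) :
    ∫⁻ θ in Set.Ioo (-Real.pi) Real.pi, ENNReal.ofReal ‖geomDeriv k (circleMap 0 r θ)‖ ≤
      ENNReal.ofReal (72 * k * Real.log (2 * k)) := by
  have hk0 : (0 : ℝ) < k := by exact_mod_cast hk
  have hk1 : (1 : ℝ) ≤ k := by exact_mod_cast hk
  calc _ ≤ ∫⁻ θ in Set.Ioo (-Real.pi) Real.pi,
          ENNReal.ofReal (12 * k) * ENNReal.ofReal (1 / (1 / k + |θ|)) := by
        refine setLIntegral_mono' measurableSet_Ioo fun θ hθ => ?_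
        rw [← ENNReal.ofReal_mul (by positivity), circleMap_zero]
        exact ENNReal.ofReal_le_ofReal
          (norm_geomDeriv_le_of_inner hk hr0 hr (abs_le.2 ⟨hθ.1.le, hθ.2.le⟩))
    _ = ENNReal.ofReal (12 * k) *
        ∫⁻ θ in Set.Ioo (-Real.pi) Real.pi, ENNReal.ofReal (1 / (1 / k + |θ|)) := by
        rw [lintegral_const_mul _ (by fun_prop)]
    _ ≤ ENNReal.ofReal (12 * k) * ENNReal.ofReal (6 * Real.log (2 / (1 / k))) := by
        gcongr
        exact setLIntegral_one_div_add_abs_le (by positivity) (by rw [div_le_one hk0]; exact hk1)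
    _ = _ := by
        rw [← ENNReal.ofReal_mul (by positivity)]
        congr 1; rw [div_div_eq_mul_div, div_one]; ring

/-! ### Radial integrals compared with the weights `logWeight α n`. -/

/-- The weight `log^α (n + 2) / (n + 1)`. -/
noncomputable def logWeight (α : ℝ) (n : ℕ) : ℝ := Real.log ((n : ℝ) + 2) ^ α / ((n : ℝ) + 1)

lemma log_natCast_add_two_pos (n : ℕ) : 0 < Real.log ((n : ℝ) + 2) :=
  Real.log_pos (by have : (0 : ℝ) ≤ n := n.cast_nonneg; linarith)

lemma logWeight_pos (α : ℝ) (n : ℕ) : 0 < logWeight α n := by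
  have := log_natCast_add_two_pos n
  unfold logWeight; positivity

/-- The exponent `|α|` gives one constant for both signs of `α`; the ratio `3` is the one supplied
by `log_two_div_comparable`. -/
lemma rpow_le_rpow_of_comparable (α : ℝ) {x y : ℝ} (hx : 0 < x) (hxy : x ≤ y) (hyx : y ≤ 3 * x) :
    y ^ α ≤ 3 ^ |α| * x ^ α ∧ x ^ α ≤ 3 ^ |α| * y ^ α := by
  have hy : 0 < y := hx.trans_le hxy
  have h3 : (1 : ℝ) ≤ 3 ^ |α| := Real.one_le_rpow (by norm_num) (abs_nonneg α)
  have hxa : 0 < x ^ α := by positivity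
  have hya : 0 < y ^ α := by positivity
  rcases le_total 0 α with h | h
  · have h1 := Real.rpow_le_rpow hy.le hyx h
    rw [Real.mul_rpow (by norm_num) hx.le] at h1
    have h2 := Real.rpow_le_rpow hx.le hxy h
    rw [abs_of_nonneg h] at h3 ⊢
    exact ⟨h1, by nlinarith⟩
  · have h1 := Real.rpow_le_rpow_of_nonpos hx hxy h
    have h2 := Real.rpow_le_rpow_of_nonpos hy hyx h
    rw [Real.mul_rpow (by norm_num) hx.le] at h2
    refine ⟨by nlinarith, ?_⟩
    rw [abs_of_nonpos h]
    have h4 : (3 : ℝ) ^ (-α) * 3 ^ α = 1 := by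
      rw [← Real.rpow_add (by norm_num)]; simp
    have h5 : (0 : ℝ) < 3 ^ (-α) := by positivity
    calc x ^ α = 3 ^ (-α) * (3 ^ α * x ^ α) := by rw [← mul_assoc, h4, one_mul]
      _ ≤ _ := by gcongr

/-- In this window `n + 2 ≤ 2/s ≤ 8 (n + 1) ≤ (n + 2)^3`. -/
lemma log_two_div_comparable (n : ℕ) {s : ℝ} (h1 : 1 / (4 * ((n : ℝ) + 1)) ≤ s)
    (h2 : s ≤ 1 / ((n : ℝ) + 1)) :
    Real.log ((n : ℝ) + 2) ≤ Real.log (2 / s) ∧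
      Real.log (2 / s) ≤ 3 * Real.log ((n : ℝ) + 2) := by
  have hn : (0 : ℝ) ≤ n := n.cast_nonneg
  have hs : 0 < s := lt_of_lt_of_le (by positivity) h1
  rw [le_div_iff₀ (by positivity)] at h2
  rw [div_le_iff₀ (by positivity)] at h1
  constructor
  · apply Real.log_le_log (by positivity)
    rw [le_div_iff₀ hs]
    nlinarith
  · rw [show (3 : ℝ) = ((3 : ℕ) : ℝ) by norm_num, ← Real.log_pow]
    apply Real.log_le_log (by positivity)
    rw [div_le_iff₀ hs]
    have : 8 * ((n : ℝ) + 1) ≤ (n + 2) ^ 3 := by nlinarith [mul_nonneg hn hn, pow_nonneg hn 3]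
    nlinarith

/-- Only the window `A < 1 - r < 2A` with `A = 1/(4(n+1))` is kept: its length is `A`, the logarithm
there is comparable to `log (n + 2)`, and `r ^ n ≥ 1/2` by Bernoulli. -/
lemma logWeight_le_setLIntegral (α : ℝ) (n : ℕ) :
    ENNReal.ofReal ((3 ^ |α|)⁻¹ / 8 * logWeight α n) ≤
      ∫⁻ r in Set.Ioo (0 : ℝ) 1, ENNReal.ofReal (r ^ n * Real.log (2 / (1 - r)) ^ α) := by
  have hn : (0 : ℝ) ≤ n := n.cast_nonneg
  set A : ℝ := 1 / (4 * ((n : ℝ) + 1)) with hA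
  have hA0 : 0 < A := by positivity
  have hA1 : A * (4 * ((n : ℝ) + 1)) = 1 := by rw [hA]; field_simp
  have hA4 : 2 * A ≤ 1 / ((n : ℝ) + 1) := by
    rw [hA, mul_one_div, div_le_div_iff₀ (by positivity) (by positivity)]; linarith
  have hA2 : 2 * A ≤ 1 := by nlinarith
  have hc : ∀ r ∈ Set.Ioo (1 - 2 * A) (1 - A),
      (3 ^ |α|)⁻¹ / 2 * Real.log ((n : ℝ) + 2) ^ α ≤ r ^ n * Real.log (2 / (1 - r)) ^ α := by
    intro r hr
    obtain ⟨h1, h2⟩ := hr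
    obtain ⟨h3, h4⟩ := log_two_div_comparable n (s := 1 - r) (by linarith) (by linarith)
    have h5 := (rpow_le_rpow_of_comparable α (log_natCast_add_two_pos n) h3 h4).2
    have h6 : 1 / 2 ≤ r ^ n := by
      have := one_add_mul_le_pow (a := r - 1) (by linarith) n
      rw [add_sub_cancel] at this
      nlinarith
    have h7 : (3 ^ |α|)⁻¹ * Real.log ((n : ℝ) + 2) ^ α ≤ Real.log (2 / (1 - r)) ^ α := by
      rw [inv_mul_le_iff₀ (by positivity)]; exact h5
    have h8 : 0 ≤ Real.log ((n : ℝ) + 2) ^ α :=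
      Real.rpow_nonneg (log_natCast_add_two_pos n).le _
    calc _ = 1 / 2 * ((3 ^ |α|)⁻¹ * Real.log ((n : ℝ) + 2) ^ α) := by ring
      _ ≤ _ := by gcongr
  calc _ = ∫⁻ r in Set.Ioo (1 - 2 * A) (1 - A),
        ENNReal.ofReal ((3 ^ |α|)⁻¹ / 2 * Real.log ((n : ℝ) + 2) ^ α) := by
        rw [setLIntegral_const, Real.volume_Ioo, ← ENNReal.ofReal_mul]
        · congr 1
          rw [logWeight, show 1 - A - (1 - 2 * A) = A by ring, hA]
          field_simp; ring
        · have := log_natCast_add_two_pos n; positivity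
    _ ≤ ∫⁻ r in Set.Ioo (1 - 2 * A) (1 - A),
        ENNReal.ofReal (r ^ n * Real.log (2 / (1 - r)) ^ α) :=
        setLIntegral_mono' measurableSet_Ioo fun r hr => ENNReal.ofReal_le_ofReal (hc r hr)
    _ ≤ _ := lintegral_mono_set (Set.Ioo_subset_Ioo (by linarith) (by linarith))

lemma lintegral_finset_biUnion_le {ι X : Type*} [MeasurableSpace X] {μ : Measure X}
    (s : Finset ι) (t : ι → Set X) (g : X → ℝ≥0∞) :
    ∫⁻ x in ⋃ i ∈ s, t i, g x ∂μ ≤ ∑ i ∈ s, ∫⁻ x in t i, g x ∂μ := by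
  have h : ⋃ i ∈ s, t i = ⋃ i : s, t i := by ext; simp
  rw [h]
  exact (lintegral_iUnion_le _ _).trans_eq
    (Finset.tsum_subtype s fun i => ∫⁻ x in t i, g x ∂μ)

/-- The slice `1/(n+2) ≤ 1 - r ≤ 1/(n+1)` has length `1/((n+1)(n+2))`, and `1/(1-r) ≤ n + 2` on it,
so it contributes about `logWeight α n`. -/
lemma setLIntegral_one_div_mul_log_rpow_le (α : ℝ) {k : ℕ} (hk : 1 ≤ k) :
    ∫⁻ r in Set.Ioc (0 : ℝ) (1 - 1 / k),
        ENNReal.ofReal (1 / (1 - r) * Real.log (2 / (1 - r)) ^ α) ≤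
      ∑ n ∈ Finset.range (k + 1), ENNReal.ofReal (3 ^ |α| * logWeight α n) := by
  have hk0 : (0 : ℝ) < k := by exact_mod_cast hk
  have hsub : Set.Ioc (0 : ℝ) (1 - 1 / k) ⊆ ⋃ n ∈ Finset.range (k + 1),
      Set.Icc (1 - 1 / ((n : ℝ) + 1)) (1 - 1 / ((n : ℝ) + 2)) := by
    intro r hr
    have h1 : 1 / (k : ℝ) ≤ 1 - r := by linarith [hr.2]
    have hs : 0 < 1 - r := lt_of_lt_of_le (by positivity) h1
    have hs1 : 1 ≤ 1 / (1 - r) := by rw [le_div_iff₀ hs]; linarith [hr.1]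
    obtain ⟨n, hn⟩ : ∃ n, ⌊1 / (1 - r)⌋₊ = n + 1 :=
      Nat.exists_eq_succ_of_ne_zero (Nat.floor_pos.2 hs1).ne'
    have h2 : (n : ℝ) + 1 ≤ 1 / (1 - r) := by
      have := Nat.floor_le (show 0 ≤ 1 / (1 - r) by positivity)
      rw [hn] at this; push_cast at this; exact this
    have h3 : 1 / (1 - r) < (n : ℝ) + 2 := by
      have := Nat.lt_floor_add_one (1 / (1 - r))
      rw [hn] at this; push_cast at this; linarith
    simp only [Set.mem_iUnion, Finset.mem_range]
    refine ⟨n, ?_, ?_, ?_⟩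
    · have h4 : 1 / (1 - r) ≤ k := by
        rw [div_le_iff₀ hs]; rw [div_le_iff₀ hk0] at h1; linarith
      have : (n : ℝ) + 1 ≤ k := h2.trans h4
      have : n + 1 ≤ k := by exact_mod_cast this
      omega
    · have : 1 - r ≤ 1 / ((n : ℝ) + 1) := by
        rw [le_div_iff₀ (by positivity)]; rw [le_div_iff₀ hs] at h2; linarith
      linarith
    · have : 1 / ((n : ℝ) + 2) ≤ 1 - r := by
        rw [div_le_iff₀ (by positivity)]; rw [div_lt_iff₀ hs] at h3; linarith
      linarith
  refine (lintegral_mono_set hsub).trans ((lintegral_finset_biUnion_le _ _ _).trans ?_)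
  refine Finset.sum_le_sum fun n _ => ?_
  have hn : (0 : ℝ) ≤ n := n.cast_nonneg
  have hL := log_natCast_add_two_pos n
  calc _ ≤ ∫⁻ r in Set.Icc (1 - 1 / ((n : ℝ) + 1)) (1 - 1 / ((n : ℝ) + 2)),
        ENNReal.ofReal (((n : ℝ) + 2) * (3 ^ |α| * Real.log ((n : ℝ) + 2) ^ α)) := by
        refine setLIntegral_mono' measurableSet_Icc fun r hr => ENNReal.ofReal_le_ofReal ?_
        obtain ⟨h1, h2⟩ := hr
        have h0 : 1 / ((n : ℝ) + 2) ≤ 1 - r := by linarith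
        have hs : 0 < 1 - r := lt_of_lt_of_le (by positivity) h0
        obtain ⟨h3, h4⟩ := log_two_div_comparable n (s := 1 - r)
          ((one_div_le_one_div_of_le (by positivity) (by linarith)).trans h0) (by linarith)
        have h5 := (rpow_le_rpow_of_comparable α hL h3 h4).1
        have h6 : 1 / (1 - r) ≤ (n : ℝ) + 2 := by
          rw [div_le_iff₀ hs]; rw [div_le_iff₀ (by positivity)] at h0; linarith
        have h7 : 0 ≤ Real.log (2 / (1 - r)) ^ α := Real.rpow_nonneg (hL.le.trans h3) _
        gcongr
    _ = _ := by
        rw [setLIntegral_const, Real.volume_Icc, ← ENNReal.ofReal_mul (by positivity)]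
        congr 1
        rw [logWeight]
        field_simp; ring

/-- Slow variation of `log^α`. Any exponent in `(0, 1)` would do in place of `1/2`: the resulting
power of `1 - r` must stay integrable at `r = 1`. -/
lemma log_mul_rpow_le (α : ℝ) {y x : ℝ} (hy : 2 ≤ y) (hx : 1 ≤ x) :
    Real.log (y * x) ^ α ≤ (1 + 4 * |α|) ^ |α| * Real.log y ^ α * x ^ (1 / 2 : ℝ) := by
  have hlog2 : (1 : ℝ) / 2 ≤ Real.log y := by
    have := Real.log_two_gt_d9
    have := Real.log_le_log (by norm_num) hy
    linarith
  have hy0 : 0 < Real.log y := by linarith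
  have hlx : 0 ≤ Real.log x := Real.log_nonneg hx
  have hx0 : 0 < x := by linarith
  rw [Real.log_mul (by linarith) hx0.ne']
  have hx2 : 1 ≤ x ^ (1 / 2 : ℝ) := Real.one_le_rpow hx (by norm_num)
  have hc : 1 ≤ (1 + 4 * |α|) ^ |α| :=
    Real.one_le_rpow (by linarith [abs_nonneg α]) (abs_nonneg α)
  have hya : 0 < Real.log y ^ α := by positivity
  rcases le_or_gt α 0 with h | h
  · calc _ ≤ Real.log y ^ α := Real.rpow_le_rpow_of_nonpos hy0 (by linarith) h
      _ = 1 * Real.log y ^ α * 1 := by ring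
      _ ≤ _ := by gcongr
  · rw [abs_of_pos h]
    -- This `ε` becomes the exponent `1/2` after raising to the power `α`.
    have h1 := Real.log_le_rpow_div hx0.le (ε := 1 / (2 * α)) (by positivity)
    have h2 : 1 ≤ x ^ (1 / (2 * α)) := Real.one_le_rpow hx (by positivity)
    rw [div_div_eq_mul_div, div_one] at h1
    have h3 : Real.log y + Real.log x ≤ (1 + 4 * α) * Real.log y * x ^ (1 / (2 * α)) := by
      have h4 : Real.log y ≤ Real.log y * x ^ (1 / (2 * α)) := le_mul_of_one_le_right hy0.le h2
      have h5 : x ^ (1 / (2 * α)) * (2 * α) ≤ x ^ (1 / (2 * α)) * (4 * α * Real.log y) :=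
        mul_le_mul_of_nonneg_left (by nlinarith) (by positivity)
      linarith
    calc _ ≤ ((1 + 4 * α) * Real.log y * x ^ (1 / (2 * α))) ^ α :=
          Real.rpow_le_rpow (by linarith) h3 h.le
      _ = _ := by
          rw [Real.mul_rpow (by positivity) (by positivity), Real.mul_rpow (by positivity) hy0.le,
            ← Real.rpow_mul hx0.le]
          congr 2; field_simp

lemma setLIntegral_log_rpow_le (α : ℝ) {k : ℕ} (hk : 1 ≤ k) :
    ∫⁻ r in Set.Ioo (1 - 1 / (k : ℝ)) 1, ENNReal.ofReal (Real.log (2 / (1 - r)) ^ α) ≤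
      ENNReal.ofReal (2 * (1 + 4 * |α|) ^ |α| * (Real.log (2 * k) ^ α / k)) := by
  have hk0 : (0 : ℝ) < k := by exact_mod_cast hk
  have hk1 : (1 : ℝ) ≤ k := by exact_mod_cast hk
  have hL : 0 < Real.log (2 * k) := Real.log_pos (by linarith)
  set D : ℝ := (1 + 4 * |α|) ^ |α| * Real.log (2 * k) ^ α with hD
  have hD0 : 0 ≤ D := by have := abs_nonneg α; positivity
  have hle : 1 - 1 / (k : ℝ) ≤ 1 := by have : 0 < 1 / (k : ℝ) := by positivity
                                       linarith
  have hint : IntervalIntegrable (fun s : ℝ => s ^ (-(1 / 2) : ℝ)) volume 0 (1 / k) :=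
    intervalIntegral.intervalIntegrable_rpow' (by norm_num)
  have hval : ∫ s in (0 : ℝ)..(1 / k), s ^ (-(1 / 2) : ℝ) = 2 * (1 / k : ℝ) ^ (1 / 2 : ℝ) := by
    rw [integral_rpow (Or.inl (by norm_num)), Real.zero_rpow (by norm_num)]
    norm_num; ring
  have hi2 : IntervalIntegrable (fun r : ℝ => (1 - r) ^ (-(1 / 2) : ℝ)) volume (1 - 1 / k) 1 := by
    have := hint.symm.comp_sub_left 1
    simpa using this
  calc _ ≤ ∫⁻ r in Set.Ioo (1 - 1 / (k : ℝ)) 1,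
        ENNReal.ofReal (D * (1 / k : ℝ) ^ (1 / 2 : ℝ) * (1 - r) ^ (-(1 / 2) : ℝ)) := by
        refine setLIntegral_mono' measurableSet_Ioo fun r hr => ENNReal.ofReal_le_ofReal ?_
        have hs : 0 < 1 - r := by linarith [hr.2]
        have hsk : 1 - r ≤ 1 / k := by linarith [hr.1]
        -- Here `y * x = 2 / (1 - r)`, and `x ≥ 1` because `1 - r ≤ 1/k`.
        have h := log_mul_rpow_le α (y := 2 * k) (x := 1 / k / (1 - r)) (by linarith)
          (by rw [le_div_iff₀ hs]; linarith)
        rw [show 2 * (k : ℝ) * (1 / k / (1 - r)) = 2 / (1 - r) by field_simp] at h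
        refine h.trans (le_of_eq ?_)
        rw [Real.div_rpow (by positivity) hs.le, Real.rpow_neg hs.le]
        ring
    _ = ENNReal.ofReal (D * (1 / k : ℝ) ^ (1 / 2 : ℝ) * (2 * (1 / k : ℝ) ^ (1 / 2 : ℝ))) := by
        rw [setLIntegral_Ioo_ofReal_eq hle (hi2.const_mul _), intervalIntegral.integral_const_mul,
          intervalIntegral.integral_comp_sub_left (fun s : ℝ => s ^ (-(1 / 2) : ℝ)) 1]
        · rw [sub_self, sub_sub_cancel, hval]
        · intro r hr
          have : 0 < 1 - r := by linarith [hr.2]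
          positivity
    _ = _ := by
        congr 1
        have : (1 / k : ℝ) ^ (1 / 2 : ℝ) * (1 / k : ℝ) ^ (1 / 2 : ℝ) = 1 / k := by
          rw [← Real.rpow_add (by positivity)]; norm_num
        linear_combination 2 * D * this

/-- For `α ≤ 0`, each `log^α (n + 2)` is at least `log^α (k + 2)`, and the harmonic sum supplies the
remaining logarithm. For `α ≥ 0`, the left side telescopes. -/
lemma log_rpow_add_one_le_sum (α : ℝ) (k : ℕ) :
    Real.log ((k : ℝ) + 2) ^ (α + 1) ≤
      (|α| + 1) * ∑ n ∈ Finset.range (k + 1), logWeight α n := by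
  rcases le_total α 0 with h | h
  · have hs : 0 ≤ ∑ n ∈ Finset.range (k + 1), logWeight α n :=
      Finset.sum_nonneg fun n _ => (logWeight_pos α n).le
    have h1 : Real.log ((k : ℝ) + 2) ^ (α + 1) ≤ ∑ n ∈ Finset.range (k + 1), logWeight α n := by
      have hh := log_add_one_le_harmonic (k + 1)
      rw [harmonic] at hh
      push_cast at hh
      rw [show (k : ℝ) + 1 + 1 = k + 2 by ring] at hh
      have hL := log_natCast_add_two_pos k
      rw [Real.rpow_add_one hL.ne']
      calc _ ≤ Real.log ((k : ℝ) + 2) ^ α * ∑ n ∈ Finset.range (k + 1), ((n : ℝ) + 1)⁻¹ := by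
            gcongr
        _ = ∑ n ∈ Finset.range (k + 1), Real.log ((k : ℝ) + 2) ^ α * ((n : ℝ) + 1)⁻¹ :=
            Finset.mul_sum _ _ _
        _ ≤ _ := by
            refine Finset.sum_le_sum fun n hn => ?_
            rw [logWeight, div_eq_mul_inv]
            refine mul_le_mul_of_nonneg_right ?_ (by positivity)
            refine Real.rpow_le_rpow_of_nonpos (log_natCast_add_two_pos n) ?_ h
            have : (n : ℝ) ≤ k := by
              exact_mod_cast Nat.lt_succ_iff.1 (Finset.mem_range.1 hn)
            exact Real.log_le_log (by positivity) (by linarith)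
    nlinarith [abs_nonneg α]
  · rw [abs_of_nonneg h]
    -- Convexity of `t ^ (α + 1)`, as Bernoulli's inequality for `x / y`.
    have key : ∀ x y : ℝ, 0 ≤ x → 0 < y → y ^ (α + 1) - x ^ (α + 1) ≤ (α + 1) * (y ^ α * (y - x)) := by
      intro x y hx hy
      have hb := one_add_mul_self_le_rpow_one_add (s := (x - y) / y)
        (by rw [le_div_iff₀ hy]; linarith) (p := α + 1) (by linarith)
      rw [show 1 + (x - y) / y = x / y by field_simp; ring, Real.div_rpow hx hy.le,
        le_div_iff₀ (by positivity), Real.rpow_add_one hy.ne'] at hb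
      rw [Real.rpow_add_one hy.ne']
      have : (1 + (α + 1) * ((x - y) / y)) * (y ^ α * y)
          = y ^ α * y + (α + 1) * (y ^ α * (x - y)) := by field_simp
      linarith
    have step : ∀ n : ℕ, Real.log ((n : ℝ) + 2) ^ (α + 1) - Real.log ((n : ℝ) + 1) ^ (α + 1) ≤
        (α + 1) * logWeight α n := by
      intro n
      have hn : (0 : ℝ) ≤ n := n.cast_nonneg
      have hL := log_natCast_add_two_pos n
      refine (key _ _ (Real.log_nonneg (by linarith)) hL).trans ?_
      rw [logWeight, div_eq_mul_inv]
      gcongr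
      rw [← Real.log_div (by positivity) (by positivity)]
      refine (Real.log_le_sub_one_of_pos (by positivity)).trans (le_of_eq ?_)
      field_simp; ring
    rw [Finset.mul_sum]
    induction k with
    | zero =>
      have := step 0
      simp only [Nat.cast_zero, zero_add, Real.log_one] at this
      rw [Real.zero_rpow (by linarith), sub_zero] at this
      simpa using this
    | succ k ih =>
      rw [Finset.sum_range_succ]
      have := step (k + 1)
      push_cast at this ⊢
      rw [show (k : ℝ) + 1 + 1 = k + 2 by ring] at this
      linarith

/-! ### The weighted area integral of `geomDeriv k`. -/

/-- A constant bounding the `𝔅¹_{log^α}` seminorms of `1 + z + ⋯ + z ^ k`. -/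
noncomputable def geomConst (α : ℝ) : ℝ :=
  100 * 3 ^ |α| +
    (30 + 144 * (1 + 4 * |α|) ^ |α|) * (2 ^ (α + 1) * (|α| + 1))

lemma measurable_log_two_div_rpow (α : ℝ) :
    Measurable fun r : ℝ => Real.log (2 / (1 - r)) ^ α := by
  fun_prop

lemma log_two_div_nonneg {r : ℝ} (h0 : 0 ≤ r) (h1 : r < 1) : 0 ≤ Real.log (2 / (1 - r)) :=
  Real.log_nonneg (by rw [le_div_iff₀ (by linarith)]; linarith)

lemma setLIntegral_outer_le (α : ℝ) (hα : -1 ≤ α) {k : ℕ} (hk : 1 ≤ k) :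
    ∫⁻ r in Set.Ioc (0 : ℝ) (1 - 1 / k), ENNReal.ofReal r *
        ENNReal.ofReal (Real.log (2 / (1 - r)) ^ α) *
          ∫⁻ θ in Set.Ioo (-Real.pi) Real.pi, ENNReal.ofReal ‖geomDeriv k (circleMap 0 r θ)‖ ≤
      ENNReal.ofReal (100 * 3 ^ |α| * ∑ n ∈ Finset.range (k + 1), logWeight α n +
        30 * Real.log (2 * k) ^ (α + 1)) := by
  have hk0 : (0 : ℝ) < k := by exact_mod_cast hk
  have hk1 : (1 : ℝ) ≤ k := by exact_mod_cast hk
  have hk2 : 0 ≤ Real.log (2 * k) := Real.log_nonneg (by linarith)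
  have hs : 0 ≤ ∑ n ∈ Finset.range (k + 1), logWeight α n :=
    Finset.sum_nonneg fun n _ => (logWeight_pos α n).le
  have hlt : ∀ r ∈ Set.Ioc (0 : ℝ) (1 - 1 / k), r < 1 := fun r hr => by
    have : 0 < 1 / (k : ℝ) := by positivity
    linarith [hr.2]
  calc _ ≤ ∫⁻ r in Set.Ioc (0 : ℝ) (1 - 1 / k),
        (ENNReal.ofReal 100 * ENNReal.ofReal (1 / (1 - r) * Real.log (2 / (1 - r)) ^ α) +
          ENNReal.ofReal (30 * Real.log (2 * k) ^ (α + 1)) * ENNReal.ofReal (k * r ^ k)) := by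
        refine setLIntegral_mono' measurableSet_Ioc fun r hr => ?_
        have h0 := hr.1
        have h1 := hlt r hr
        have hs : 0 < 1 - r := by linarith
        have hL := log_two_div_nonneg h0.le h1
        have hL0 : Real.log (2 / (1 - r)) ≠ 0 :=
          (Real.log_pos (by rw [lt_div_iff₀ hs]; linarith)).ne'
        have hLk : Real.log (2 / (1 - r)) ≤ Real.log (2 * k) := by
          apply Real.log_le_log (by positivity)
          rw [div_le_iff₀ hs]
          have : 1 / (k : ℝ) ≤ 1 - r := by linarith [hr.2]
          rw [div_le_iff₀ hk0] at this
          linarith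
        calc _ ≤ ENNReal.ofReal r * ENNReal.ofReal (Real.log (2 / (1 - r)) ^ α) *
              ENNReal.ofReal (100 * (1 / (1 - r)) +
                30 * k * r ^ k * Real.log (2 / (1 - r))) := by
              gcongr; exact setLIntegral_geomDeriv_le_of_outer k h0.le h1
          _ = ENNReal.ofReal (r * Real.log (2 / (1 - r)) ^ α * (100 * (1 / (1 - r)) +
                30 * k * r ^ k * Real.log (2 / (1 - r)))) := by
              rw [← ENNReal.ofReal_mul h0.le, ← ENNReal.ofReal_mul (by positivity)]
          _ ≤ ENNReal.ofReal (1 * Real.log (2 / (1 - r)) ^ α * (100 * (1 / (1 - r)) +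
                30 * k * r ^ k * Real.log (2 / (1 - r)))) := by
              gcongr
          _ ≤ ENNReal.ofReal (100 * (1 / (1 - r) * Real.log (2 / (1 - r)) ^ α) +
                30 * Real.log (2 * k) ^ (α + 1) * (k * r ^ k)) := by
              apply ENNReal.ofReal_le_ofReal
              -- Monotonicity of the power requires `α + 1 ≥ 0`.
              have h2 : Real.log (2 / (1 - r)) ^ (α + 1) ≤ Real.log (2 * k) ^ (α + 1) :=
                Real.rpow_le_rpow hL hLk (by linarith)
              calc _ = 100 * (1 / (1 - r) * Real.log (2 / (1 - r)) ^ α) +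
                    30 * Real.log (2 / (1 - r)) ^ (α + 1) * (k * r ^ k) := by
                    rw [Real.rpow_add_one hL0]; ring
                _ ≤ _ := by gcongr
          _ = _ := by
              rw [ENNReal.ofReal_add (by positivity) (by positivity),
                ENNReal.ofReal_mul (p := 100) (by positivity),
                ENNReal.ofReal_mul (p := 30 * Real.log (2 * k) ^ (α + 1)) (by positivity)]
    _ = ENNReal.ofReal 100 * (∫⁻ r in Set.Ioc (0 : ℝ) (1 - 1 / k),
          ENNReal.ofReal (1 / (1 - r) * Real.log (2 / (1 - r)) ^ α)) +
        ENNReal.ofReal (30 * Real.log (2 * k) ^ (α + 1)) *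
          ∫⁻ r in Set.Ioc (0 : ℝ) (1 - 1 / k), ENNReal.ofReal (k * r ^ k) := by
        rw [lintegral_add_left (by fun_prop), lintegral_const_mul _ (by fun_prop),
          lintegral_const_mul _ (by fun_prop)]
    _ ≤ ENNReal.ofReal 100 * (∑ n ∈ Finset.range (k + 1),
          ENNReal.ofReal (3 ^ |α| * logWeight α n)) +
        ENNReal.ofReal (30 * Real.log (2 * k) ^ (α + 1)) * 1 := by
        gcongr
        · exact setLIntegral_one_div_mul_log_rpow_le α hk
        · calc _ ≤ ∫⁻ r in Set.Ioo (0 : ℝ) 1, ENNReal.ofReal (k * r ^ k) :=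
                lintegral_mono_set fun r hr => ⟨hr.1, hlt r hr⟩
            _ = ENNReal.ofReal (k * (1 / (k + 1))) := by
                rw [setLIntegral_Ioo_ofReal_eq zero_le_one
                  (Continuous.intervalIntegrable (by fun_prop) _ _),
                  intervalIntegral.integral_const_mul, integral_pow]
                · simp
                · intro r hr
                  have := hr.1
                  positivity
            _ ≤ 1 := by
                rw [ENNReal.ofReal_le_one, mul_one_div, div_le_one (by positivity)]
                linarith
    _ = _ := by
        rw [← ENNReal.ofReal_sum_of_nonneg
          (fun n _ => mul_nonneg (by positivity) (logWeight_pos α n).le), ← Finset.mul_sum,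
          ← ENNReal.ofReal_mul (by norm_num), mul_one,
          ← ENNReal.ofReal_add (by positivity) (by positivity), mul_assoc]

lemma setLIntegral_inner_le (α : ℝ) {k : ℕ} (hk : 1 ≤ k) :
    ∫⁻ r in Set.Ioo (1 - 1 / (k : ℝ)) 1, ENNReal.ofReal r *
        ENNReal.ofReal (Real.log (2 / (1 - r)) ^ α) *
          ∫⁻ θ in Set.Ioo (-Real.pi) Real.pi, ENNReal.ofReal ‖geomDeriv k (circleMap 0 r θ)‖ ≤
      ENNReal.ofReal (144 * (1 + 4 * |α|) ^ |α| * Real.log (2 * k) ^ (α + 1)) := by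
  have hk0 : (0 : ℝ) < k := by exact_mod_cast hk
  have hk1 : (1 : ℝ) ≤ k := by exact_mod_cast hk
  have hk2 : 0 < Real.log (2 * k) := Real.log_pos (by linarith)
  have ha := abs_nonneg α
  calc _ ≤ ∫⁻ r in Set.Ioo (1 - 1 / (k : ℝ)) 1, ENNReal.ofReal (72 * k * Real.log (2 * k)) *
        ENNReal.ofReal (Real.log (2 / (1 - r)) ^ α) := by
        refine setLIntegral_mono' measurableSet_Ioo fun r hr => ?_
        have h0 : 0 ≤ r := by
          have : 1 / (k : ℝ) ≤ 1 := by rw [div_le_one hk0]; exact hk1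
          linarith [hr.1]
        rw [mul_comm]
        gcongr
        · exact setLIntegral_geomDeriv_le_of_inner hk h0 hr.2.le
        · refine mul_le_of_le_one_left (by positivity) ?_
          rw [ENNReal.ofReal_le_one]; exact hr.2.le
    _ = ENNReal.ofReal (72 * k * Real.log (2 * k)) *
        ∫⁻ r in Set.Ioo (1 - 1 / (k : ℝ)) 1, ENNReal.ofReal (Real.log (2 / (1 - r)) ^ α) :=
        lintegral_const_mul _ (by fun_prop)
    _ ≤ ENNReal.ofReal (72 * k * Real.log (2 * k)) *
        ENNReal.ofReal (2 * (1 + 4 * |α|) ^ |α| * (Real.log (2 * k) ^ α / k)) := by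
        gcongr; exact setLIntegral_log_rpow_le α hk
    _ = _ := by
        rw [← ENNReal.ofReal_mul (by positivity), Real.rpow_add_one hk2.ne']
        congr 1
        field_simp; ring

lemma lintegral_geomDeriv_le (α : ℝ) (hα : -1 ≤ α) (k : ℕ) :
    ∫⁻ z, ENNReal.ofReal (‖geomDeriv k z‖ * Real.log (2 / (1 - ‖z‖)) ^ α) ∂diskArea ≤
      ENNReal.ofReal (geomConst α) * ∑ n ∈ Finset.range (k + 1), ENNReal.ofReal (logWeight α n) := by
  -- The splitting radius `1 - 1/k` is meaningless for `k = 0`, but then the kernel vanishes.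
  rcases Nat.eq_zero_or_pos k with rfl | hk
  · simp [geomDeriv]
  have hk0 : (0 : ℝ) < k := by exact_mod_cast hk
  have hk1 : (1 : ℝ) ≤ k := by exact_mod_cast hk
  have hk2 : 0 < Real.log (2 * k) := Real.log_pos (by linarith)
  have ha := abs_nonneg α
  have hS : 0 ≤ ∑ n ∈ Finset.range (k + 1), logWeight α n :=
    Finset.sum_nonneg fun n _ => (logWeight_pos α n).le
  rw [lintegral_diskArea_eq_polar (h := geomDeriv k) (φ := fun r => Real.log (2 / (1 - r)) ^ α)
    (continuous_geomDeriv k).measurable (measurable_log_two_div_rpow α)]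
  have hpi : (ENNReal.ofReal Real.pi)⁻¹ ≤ 1 := by
    rw [ENNReal.inv_le_one, ← ENNReal.ofReal_one]
    exact ENNReal.ofReal_le_ofReal (by linarith [Real.pi_gt_three])
  refine (mul_le_of_le_one_left (by positivity) hpi).trans ?_
  have hsub : Set.Ioo (0 : ℝ) 1 ⊆ Set.Ioc (0 : ℝ) (1 - 1 / k) ∪ Set.Ioo (1 - 1 / (k : ℝ)) 1 := by
    intro r hr
    rcases le_or_gt r (1 - 1 / k) with h | h
    · exact Or.inl ⟨hr.1, h⟩
    · exact Or.inr ⟨h, hr.2⟩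
  refine (lintegral_mono_set hsub).trans ((lintegral_union_le _ _ _).trans ?_)
  refine (add_le_add (setLIntegral_outer_le α hα hk) (setLIntegral_inner_le α hk)).trans ?_
  rw [← ENNReal.ofReal_sum_of_nonneg (fun n _ => (logWeight_pos α n).le),
    ← ENNReal.ofReal_add (by positivity) (by positivity),
    ← ENNReal.ofReal_mul (by unfold geomConst; positivity)]
  apply ENNReal.ofReal_le_ofReal
  have h1 : Real.log (2 * k) ^ (α + 1) ≤
      2 ^ (α + 1) * ((|α| + 1) * ∑ n ∈ Finset.range (k + 1), logWeight α n) := by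
    -- From `2k ≤ (k + 2)^2`.
    have h2 : Real.log (2 * k) ≤ 2 * Real.log ((k : ℝ) + 2) := by
      rw [show (2 : ℝ) * Real.log ((k : ℝ) + 2) = ((2 : ℕ) : ℝ) * Real.log ((k : ℝ) + 2) by norm_num,
        ← Real.log_pow]
      exact Real.log_le_log (by positivity) (by nlinarith)
    calc _ ≤ (2 * Real.log ((k : ℝ) + 2)) ^ (α + 1) :=
          Real.rpow_le_rpow hk2.le h2 (by linarith)
      _ = 2 ^ (α + 1) * Real.log ((k : ℝ) + 2) ^ (α + 1) :=
          Real.mul_rpow (by norm_num) (log_natCast_add_two_pos k).le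
      _ ≤ _ := by gcongr; exact log_rpow_add_one_le_sum α k
  calc _ = 100 * 3 ^ |α| * ∑ n ∈ Finset.range (k + 1), logWeight α n +
        (30 + 144 * (1 + 4 * |α|) ^ |α|) * Real.log (2 * k) ^ (α + 1) := by ring
    _ ≤ 100 * 3 ^ |α| * ∑ n ∈ Finset.range (k + 1), logWeight α n +
        (30 + 144 * (1 + 4 * |α|) ^ |α|) *
          (2 ^ (α + 1) * ((|α| + 1) * ∑ n ∈ Finset.range (k + 1), logWeight α n)) := by gcongr
    _ = _ := by rw [geomConst]; ring

/-! ### Radial growth bounded by the mean of `|f'|` on a circle. -/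

/-- Integrate the angular derivative of `f (r e^{iθ})` against `π - θ` over `[0, 2π]`. The boundary
terms give `-2π f r`, the mean value property gives `2π f 0`, and `|π - θ| ≤ π`. -/
lemma two_mul_norm_sub_le_integral {f : ℂ → ℂ} (hf : DifferentiableOn ℂ f (Metric.ball 0 1))
    {r : ℝ} (hr0 : 0 < r) (hr : r < 1) :
    2 * ‖f r - f 0‖ ≤ r * ∫ θ in (0 : ℝ)..2 * Real.pi, ‖deriv f (circleMap 0 r θ)‖ := by
  have hmem : ∀ θ : ℝ, circleMap 0 r θ ∈ Metric.ball (0 : ℂ) 1 := fun θ => by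
    simpa [abs_of_pos hr0] using hr
  have hv : ∀ θ : ℝ, HasDerivAt (fun θ : ℝ => f (circleMap 0 r θ))
      (deriv f (circleMap 0 r θ) * (circleMap 0 r θ * Complex.I)) θ := fun θ =>
    ((hf.differentiableAt (Metric.isOpen_ball.mem_nhds (hmem θ))).hasDerivAt).comp θ
      (hasDerivAt_circleMap 0 r θ)
  have hu : ∀ θ : ℝ, HasDerivAt (fun θ : ℝ => ((Real.pi - θ : ℝ) : ℂ)) (-1) θ := fun θ => by
    have := ((hasDerivAt_id θ).const_sub Real.pi).ofReal_comp
    simpa using this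
  have hcd : Continuous fun θ : ℝ => deriv f (circleMap 0 r θ) :=
    (hf.deriv Metric.isOpen_ball).continuousOn.comp_continuous (continuous_circleMap 0 r) hmem
  have hcv : Continuous fun θ : ℝ => deriv f (circleMap 0 r θ) * (circleMap 0 r θ * Complex.I) :=
    hcd.mul ((continuous_circleMap 0 r).mul continuous_const)
  have hmean : ∫ θ in (0 : ℝ)..2 * Real.pi, f (circleMap 0 r θ) = 2 * Real.pi * f 0 := by
    have h1 : DiffContOnCl ℂ f (Metric.ball 0 |r|) := by
      apply DifferentiableOn.diffContOnCl
      refine hf.mono ((Metric.closure_ball_subset_closedBall).trans ?_)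
      exact Metric.closedBall_subset_ball (by rwa [abs_of_pos hr0])
    have h2 := h1.circleAverage
    rw [Real.circleAverage_def, inv_smul_eq_iff₀ (by positivity)] at h2
    rw [h2]; simp
  have hparts := intervalIntegral.integral_mul_deriv_eq_deriv_mul (a := 0) (b := 2 * Real.pi)
    (fun θ _ => hu θ) (fun θ _ => hv θ) (by simp)
    (hcv.intervalIntegrable _ _)
  have h0 : circleMap 0 r 0 = (r : ℂ) := by simp [circleMap]
  have h2pi : circleMap 0 r (2 * Real.pi) = (r : ℂ) := by
    rw [← h0]; simpa using periodic_circleMap 0 r 0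
  rw [h0, h2pi, intervalIntegral.integral_const_mul, hmean] at hparts
  have hnorm : ‖∫ θ in (0 : ℝ)..2 * Real.pi, ((Real.pi - θ : ℝ) : ℂ) *
      (deriv f (circleMap 0 r θ) * (circleMap 0 r θ * Complex.I))‖ =
      2 * Real.pi * ‖f r - f 0‖ := by
    rw [hparts, show ((Real.pi - 2 * Real.pi : ℝ) : ℂ) * f r - ((Real.pi - 0 : ℝ) : ℂ) * f r -
      -1 * (2 * Real.pi * f 0) = -((2 * Real.pi : ℝ) : ℂ) * (f r - f 0) by push_cast; ring,
      norm_mul, norm_neg, Complex.norm_real, Real.norm_of_nonneg (by positivity)]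
  have hle : ‖∫ θ in (0 : ℝ)..2 * Real.pi, ((Real.pi - θ : ℝ) : ℂ) *
      (deriv f (circleMap 0 r θ) * (circleMap 0 r θ * Complex.I))‖ ≤
      ∫ θ in (0 : ℝ)..2 * Real.pi, Real.pi * r * ‖deriv f (circleMap 0 r θ)‖ := by
    refine intervalIntegral.norm_integral_le_of_norm_le (by positivity) (ae_of_all _ ?_)
      ((continuous_const.mul hcd.norm).intervalIntegrable _ _)
    intro θ hθ
    rw [norm_mul, norm_mul, norm_mul, Complex.norm_I, norm_circleMap_zero, abs_of_pos hr0,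
      Complex.norm_real]
    have : ‖Real.pi - θ‖ ≤ Real.pi := by
      rw [Real.norm_eq_abs, abs_le]; constructor <;> linarith [hθ.1, hθ.2]
    calc _ = ‖Real.pi - θ‖ * (r * ‖deriv f (circleMap 0 r θ)‖) := by ring
      _ ≤ Real.pi * (r * ‖deriv f (circleMap 0 r θ)‖) := by gcongr
      _ = _ := by ring
  rw [hnorm, intervalIntegral.integral_const_mul] at hle
  refine le_of_mul_le_mul_left ?_ Real.pi_pos
  linarith

lemma ofReal_two_mul_norm_sub_le {f : ℂ → ℂ} (hf : DifferentiableOn ℂ f (Metric.ball 0 1))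
    {r : ℝ} (hr0 : 0 < r) (hr : r < 1) :
    ENNReal.ofReal (2 * ‖f r - f 0‖) ≤ ENNReal.ofReal r *
      ∫⁻ θ in Set.Ioo (-Real.pi) Real.pi, ENNReal.ofReal ‖deriv f (circleMap 0 r θ)‖ := by
  have hcd : Continuous fun θ : ℝ => deriv f (circleMap 0 r θ) :=
    (hf.deriv Metric.isOpen_ball).continuousOn.comp_continuous (continuous_circleMap 0 r)
      fun θ => by simpa [abs_of_pos hr0] using hr
  rw [setLIntegral_Ioo_ofReal_eq (by linarith [Real.pi_pos]) (hcd.norm.intervalIntegrable _ _)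
    (fun _ _ => norm_nonneg _), ← ENNReal.ofReal_mul hr0.le]
  apply ENNReal.ofReal_le_ofReal
  refine (two_mul_norm_sub_le_integral hf hr0 hr).trans (le_of_eq ?_)
  have hper : Function.Periodic (fun θ : ℝ => ‖deriv f (circleMap 0 r θ)‖) (2 * Real.pi) :=
    (periodic_circleMap 0 r).comp fun z => ‖deriv f z‖
  have := hper.intervalIntegral_add_eq 0 (-Real.pi)
  rw [zero_add, show -Real.pi + 2 * Real.pi = Real.pi by ring] at this
  rw [this]

/-! ### Termwise differentiation and Abel summation. -/

section PowerSeries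

variable {a : ℕ → ℝ} {f : ℂ → ℂ}

/-- On a ball of radius `ρ` with `‖z‖ < ρ < 1` the series is dominated by `M ρ^n`, so it may be
differentiated term by term. -/
lemma differentiableOn_and_hasSum_deriv {M : ℝ} (ha : ∀ n, |a n| ≤ M)
    (hf : ∀ z ∈ Metric.ball (0 : ℂ) 1, HasSum (fun n : ℕ => (a n : ℂ) * z ^ n) (f z)) :
    DifferentiableOn ℂ f (Metric.ball 0 1) ∧ ∀ z ∈ Metric.ball (0 : ℂ) 1,
      HasSum (fun n : ℕ => ((n : ℂ) + 1) * a (n + 1) * z ^ n) (deriv f z) := by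
  have key : ∀ z ∈ Metric.ball (0 : ℂ) 1, DifferentiableAt ℂ f z ∧
      HasSum (fun n : ℕ => ((n : ℂ) + 1) * a (n + 1) * z ^ n) (deriv f z) := by
    intro z hz
    rw [mem_ball_zero_iff] at hz
    obtain ⟨ρ, h1, h2⟩ := exists_between hz
    have hρ0 : 0 ≤ ρ := (norm_nonneg z).trans h1.le
    have hsum : Summable fun n : ℕ => M * ρ ^ n :=
      (summable_geometric_of_lt_one hρ0 h2).mul_left M
    have hzρ : z ∈ Metric.ball (0 : ℂ) ρ := by simpa using h1
    have hd : ∀ n : ℕ, DifferentiableOn ℂ (fun z : ℂ => (a n : ℂ) * z ^ n) (Metric.ball 0 ρ) :=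
      fun n => by fun_prop
    have hle : ∀ (n : ℕ) (w : ℂ), w ∈ Metric.ball (0 : ℂ) ρ → ‖(a n : ℂ) * w ^ n‖ ≤ M * ρ ^ n := by
      intro n w hw
      rw [mem_ball_zero_iff] at hw
      rw [norm_mul, norm_pow, Complex.norm_real, Real.norm_eq_abs]
      have := (abs_nonneg _).trans (ha n)
      gcongr
      exact ha n
    have heq : f =ᶠ[𝓝 z] fun w => ∑' n : ℕ, (a n : ℂ) * w ^ n := by
      filter_upwards [Metric.isOpen_ball.mem_nhds hzρ] with w hw
      exact ((hf w (Metric.ball_subset_ball h2.le hw)).tsum_eq).symm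
    refine ⟨(((Complex.differentiableOn_tsum_of_summable_norm hsum hd Metric.isOpen_ball
      hle).differentiableAt (Metric.isOpen_ball.mem_nhds hzρ))).congr_of_eventuallyEq heq, ?_⟩
    have h := Complex.hasSum_deriv_of_summable_norm hsum hd Metric.isOpen_ball hle hzρ
    rw [← heq.deriv_eq, ← hasSum_nat_add_iff' 1] at h
    simp only [Finset.range_one, Finset.sum_singleton, pow_zero, deriv_const, sub_zero] at h
    have he : ∀ n : ℕ, deriv (fun w : ℂ => (a (n + 1) : ℂ) * w ^ (n + 1)) z =
        ((n : ℂ) + 1) * a (n + 1) * z ^ n := fun n => by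
      rw [deriv_const_mul _ (by fun_prop), deriv_pow_field]
      push_cast [Nat.add_sub_cancel]; ring
    simpa only [he] using h
  exact ⟨fun z hz => (key z hz).1.differentiableWithinAt, fun z hz => (key z hz).2⟩

lemma sum_mul_pow_eq_sum_geomDeriv (a : ℕ → ℝ) (z : ℂ) (N : ℕ) :
    ∑ n ∈ Finset.range N, ((n : ℂ) + 1) * a (n + 1) * z ^ n =
      ∑ k ∈ Finset.range N, ((a k - a (k + 1) : ℝ) : ℂ) * geomDeriv k z + a N * geomDeriv N z := by
  induction N with
  | zero => simp [geomDeriv]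
  | succ N ih =>
    rw [Finset.sum_range_succ, ih, Finset.sum_range_succ]
    have : geomDeriv (N + 1) z = geomDeriv N z + ((N : ℂ) + 1) * z ^ N := by
      simp [geomDeriv, Finset.sum_range_succ]
    rw [this]; push_cast; ring

/-- The limit itself is irrelevant: its existence makes the boundary term `a N * geomDeriv N z` of
the Abel summation vanish. -/
lemma exists_tendsto_geomDeriv {z : ℂ} (hz : ‖z‖ < 1) :
    ∃ L, Tendsto (fun N => geomDeriv N z) atTop (𝓝 L) := by
  have h1 := summable_pow_mul_geometric_of_norm_lt_one 1 hz
  have h2 := summable_geometric_of_norm_lt_one hz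
  refine ⟨_, ((h1.add h2).hasSum.tendsto_sum_nat).congr fun N => ?_⟩
  unfold geomDeriv
  exact Finset.sum_congr rfl fun n _ => by ring

lemma ofReal_norm_deriv_le_tsum (hanti : Antitone a) (hlim : Tendsto a atTop (𝓝 0)) {z d : ℂ}
    (hz : ‖z‖ < 1) (hd : HasSum (fun n : ℕ => ((n : ℂ) + 1) * a (n + 1) * z ^ n) d) :
    ENNReal.ofReal ‖d‖ ≤
      ∑' k, ENNReal.ofReal (a k - a (k + 1)) * ENNReal.ofReal ‖geomDeriv k z‖ := by
  obtain ⟨L, hL⟩ := exists_tendsto_geomDeriv hz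
  have h1 : Tendsto (fun N => (a N : ℂ) * geomDeriv N z) atTop (𝓝 0) := by
    have := ((Complex.continuous_ofReal.tendsto 0).comp hlim).mul hL
    simpa using this
  have h2 : Tendsto (fun N => ∑ k ∈ Finset.range N, ((a k - a (k + 1) : ℝ) : ℂ) * geomDeriv k z)
      atTop (𝓝 d) := by
    have := hd.tendsto_sum_nat.sub h1
    rw [sub_zero] at this
    exact this.congr fun N => by rw [sum_mul_pow_eq_sum_geomDeriv]; ring
  refine le_of_tendsto ((ENNReal.continuous_ofReal.tendsto _).comp h2.norm)
    (Eventually.of_forall fun N => ?_)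
  refine le_trans ?_ (ENNReal.sum_le_tsum (Finset.range N))
  have hb : ∀ k, 0 ≤ a k - a (k + 1) := fun k => sub_nonneg.2 (hanti k.le_succ)
  simp only [Function.comp]
  calc _ ≤ ENNReal.ofReal (∑ k ∈ Finset.range N, (a k - a (k + 1)) * ‖geomDeriv k z‖) := by
        apply ENNReal.ofReal_le_ofReal
        refine (norm_sum_le _ _).trans (Finset.sum_le_sum fun k _ => ?_)
        rw [norm_mul, Complex.norm_real, Real.norm_of_nonneg (hb k)]
    _ = _ := by
        rw [ENNReal.ofReal_sum_of_nonneg fun k _ => mul_nonneg (hb k) (norm_nonneg _)]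
        exact Finset.sum_congr rfl fun k _ => ENNReal.ofReal_mul (hb k)

lemma tsum_ofReal_sub_eq (hanti : Antitone a) (hlim : Tendsto a atTop (𝓝 0)) (n : ℕ) :
    ∑' j, ENNReal.ofReal (a (j + n) - a (j + n + 1)) = ENNReal.ofReal (a n) := by
  have hb : ∀ j, 0 ≤ a (j + n) - a (j + n + 1) := fun j => sub_nonneg.2 (hanti (Nat.le_succ _))
  have h : HasSum (fun j => a (j + n) - a (j + n + 1)) (a n) := by
    rw [hasSum_iff_tendsto_nat_of_nonneg hb]
    have h1 : ∀ N, ∑ j ∈ Finset.range N, (a (j + n) - a (j + n + 1)) = a n - a (N + n) := by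
      intro N
      have := Finset.sum_range_sub' (fun j => a (j + n)) N
      simp only [zero_add] at this
      rw [← this]
      exact Finset.sum_congr rfl fun j _ => by rw [add_right_comm]
    simp only [h1]
    have := (hlim.comp (tendsto_add_atTop_nat n)).const_sub (a n)
    simpa using this
  rw [← ENNReal.ofReal_tsum_of_nonneg hb h.summable, h.tsum_eq]

/-- Tonelli: `W n` collects the differences with `k ≥ n`, which telescope to `a n`. -/
lemma tsum_ofReal_sub_mul_sum_eq (hanti : Antitone a) (hlim : Tendsto a atTop (𝓝 0))
    (W : ℕ → ℝ≥0∞) :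
    ∑' k, ENNReal.ofReal (a k - a (k + 1)) * ∑ n ∈ Finset.range (k + 1), W n =
      ∑' n, ENNReal.ofReal (a n) * W n := by
  have h1 : ∀ k, ENNReal.ofReal (a k - a (k + 1)) * ∑ n ∈ Finset.range (k + 1), W n =
      ∑' n, if n ≤ k then ENNReal.ofReal (a k - a (k + 1)) * W n else 0 := by
    intro k
    rw [tsum_eq_sum (s := Finset.range (k + 1)), Finset.mul_sum]
    · refine Finset.sum_congr rfl fun n hn => ?_
      rw [if_pos (Nat.lt_succ_iff.1 (Finset.mem_range.1 hn))]
    · intro n hn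
      rw [if_neg]
      simpa using hn
  simp_rw [h1]
  rw [ENNReal.tsum_comm]
  refine tsum_congr fun n => ?_
  rw [← tsum_ofReal_sub_eq hanti hlim n, ← ENNReal.tsum_mul_right]
  have hsplit := (ENNReal.summable (f := fun j =>
    if n ≤ j + n then ENNReal.ofReal (a (j + n) - a (j + n + 1)) * W n else 0)).sum_add_tsum_nat_add'
      (f := fun k => if n ≤ k then ENNReal.ofReal (a k - a (k + 1)) * W n else 0)
  rw [← hsplit, Finset.sum_eq_zero, zero_add]
  · simp
  · intro k hk
    rw [if_neg]
    simpa using hk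

end PowerSeries

/-! ### The two inequalities for `f`. -/

lemma logSum_eq_tsum {α : ℝ} {a : ℕ → ℝ} (h0 : ∀ n, 0 ≤ a n) :
    logSum α a = ∑' n, ENNReal.ofReal (a n) * ENNReal.ofReal (logWeight α n) := by
  unfold logSum
  refine tsum_congr fun n => ?_
  rw [← ENNReal.ofReal_mul (h0 n), logTerm, logWeight, mul_div_assoc]

lemma logTerm_nonneg {α : ℝ} {a : ℕ → ℝ} (h0 : ∀ n, 0 ≤ a n) (n : ℕ) : 0 ≤ logTerm α a n := by
  rw [logTerm, mul_div_assoc]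
  exact mul_nonneg (h0 n) (logWeight_pos α n).le

lemma logSum_lt_top_iff {α : ℝ} {a : ℕ → ℝ} (h0 : ∀ n, 0 ≤ a n) :
    logSum α a < ∞ ↔ Summable (logTerm α a) := by
  constructor
  · intro h
    have := ENNReal.summable_toReal h.ne
    refine this.congr fun n => ENNReal.toReal_ofReal (logTerm_nonneg h0 n)
  · intro h
    rw [logSum, ← ENNReal.ofReal_tsum_of_nonneg (logTerm_nonneg h0) h]
    exact ENNReal.ofReal_lt_top

section

variable {a : ℕ → ℝ} {f : ℂ → ℂ}

lemma apply_zero_of_hasSum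
    (hf : ∀ z ∈ Metric.ball (0 : ℂ) 1, HasSum (fun n : ℕ => (a n : ℂ) * z ^ n) (f z)) :
    f 0 = a 0 := by
  refine (hf 0 (by simp)).unique ?_
  simpa using hasSum_single (f := fun n : ℕ => (a n : ℂ) * 0 ^ n) 0
    fun n hn => by simp [hn]

lemma lintegral_deriv_le (α : ℝ) (hα : -1 ≤ α) (hanti : Antitone a)
    (hlim : Tendsto a atTop (𝓝 0)) (h0 : ∀ n, 0 ≤ a n)
    (hf : ∀ z ∈ Metric.ball (0 : ℂ) 1, HasSum (fun n : ℕ => (a n : ℂ) * z ^ n) (f z)) :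
    ∫⁻ z, ENNReal.ofReal (‖deriv f z‖ * Real.log (2 / (1 - ‖z‖)) ^ α) ∂diskArea ≤
      ENNReal.ofReal (geomConst α) * logSum α a := by
  have hM : ∀ n, |a n| ≤ a 0 := fun n => by
    rw [abs_of_nonneg (h0 n)]; exact hanti n.zero_le
  have hd := (differentiableOn_and_hasSum_deriv hM hf).2
  have hball : ∀ᵐ z ∂diskArea, z ∈ Metric.ball (0 : ℂ) 1 :=
    Measure.ae_smul_measure (ae_restrict_mem Metric.isOpen_ball.measurableSet) _
  have hmeas : ∀ k, Measurable fun z : ℂ =>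
      ENNReal.ofReal (‖geomDeriv k z‖ * Real.log (2 / (1 - ‖z‖)) ^ α) := fun k => by
    have := (continuous_geomDeriv k).measurable
    fun_prop
  calc _ ≤ ∫⁻ z, ∑' k, ENNReal.ofReal (a k - a (k + 1)) *
        ENNReal.ofReal (‖geomDeriv k z‖ * Real.log (2 / (1 - ‖z‖)) ^ α) ∂diskArea := by
        refine lintegral_mono_ae (hball.mono fun z hz => ?_)
        have h := ofReal_norm_deriv_le_tsum hanti hlim (mem_ball_zero_iff.1 hz) (hd z hz)
        simp_rw [ENNReal.ofReal_mul (norm_nonneg _), ← mul_assoc]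
        rw [ENNReal.tsum_mul_right]
        gcongr
    _ = ∑' k, ENNReal.ofReal (a k - a (k + 1)) *
        ∫⁻ z, ENNReal.ofReal (‖geomDeriv k z‖ * Real.log (2 / (1 - ‖z‖)) ^ α) ∂diskArea := by
        rw [lintegral_tsum fun k => ((hmeas k).const_mul _).aemeasurable]
        exact tsum_congr fun k => lintegral_const_mul _ (hmeas k)
    _ ≤ ∑' k, ENNReal.ofReal (a k - a (k + 1)) * (ENNReal.ofReal (geomConst α) *
        ∑ n ∈ Finset.range (k + 1), ENNReal.ofReal (logWeight α n)) := by
        gcongr with k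
        exact lintegral_geomDeriv_le α hα k
    _ = ENNReal.ofReal (geomConst α) * logSum α a := by
        rw [logSum_eq_tsum h0, ← tsum_ofReal_sub_mul_sum_eq hanti hlim, ← ENNReal.tsum_mul_left]
        exact tsum_congr fun k => by ring

/-- The indices start at `1` because `f'` does not see `a 0`. -/
lemma tsum_logWeight_le_lintegral_deriv (α : ℝ) (hanti : Antitone a) (h0 : ∀ n, 0 ≤ a n)
    (hf : ∀ z ∈ Metric.ball (0 : ℂ) 1, HasSum (fun n : ℕ => (a n : ℂ) * z ^ n) (f z)) :
    ∑' n, ENNReal.ofReal (a (n + 1)) * ENNReal.ofReal (logWeight α (n + 1)) ≤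
      ENNReal.ofReal (8 * 3 ^ |α| * Real.pi) *
        ∫⁻ z, ENNReal.ofReal (‖deriv f z‖ * Real.log (2 / (1 - ‖z‖)) ^ α) ∂diskArea := by
  have hM : ∀ n, |a n| ≤ a 0 := fun n => by
    rw [abs_of_nonneg (h0 n)]; exact hanti n.zero_le
  have hdiff := (differentiableOn_and_hasSum_deriv hM hf).1
  have hpt : ∀ r ∈ Set.Ioo (0 : ℝ) 1,
      ∑' n, ENNReal.ofReal (a (n + 1)) *
        ENNReal.ofReal (r ^ (n + 1) * Real.log (2 / (1 - r)) ^ α) ≤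
      ENNReal.ofReal r * ENNReal.ofReal (Real.log (2 / (1 - r)) ^ α) *
        ∫⁻ θ in Set.Ioo (-Real.pi) Real.pi, ENNReal.ofReal ‖deriv f (circleMap 0 r θ)‖ := by
    intro r hr
    have hr0 := hr.1
    have hterm : ∀ n, 0 ≤ a (n + 1) * r ^ (n + 1) := fun n => mul_nonneg (h0 _) (by positivity)
    -- On the positive radius the series has nonnegative terms, so its sum is at most `‖f r - f 0‖`.
    have hs : HasSum (fun n => a (n + 1) * r ^ (n + 1)) (f r - f 0).re := by
      have h := hf r (by simpa [abs_of_pos hr0] using hr.2)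
      rw [← hasSum_nat_add_iff' 1] at h
      rw [apply_zero_of_hasSum hf]
      have hre : HasSum (fun n => ((a (n + 1) * r ^ (n + 1) : ℝ) : ℂ)) (f r - a 0) := by
        simpa using h
      simpa only [Complex.ofReal_re] using Complex.hasSum_re hre
    have hle : ∑' n, ENNReal.ofReal (a (n + 1) * r ^ (n + 1)) ≤ ENNReal.ofReal r *
        ∫⁻ θ in Set.Ioo (-Real.pi) Real.pi, ENNReal.ofReal ‖deriv f (circleMap 0 r θ)‖ := by
      refine le_trans ?_ (ofReal_two_mul_norm_sub_le hdiff hr0 hr.2)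
      rw [← ENNReal.ofReal_tsum_of_nonneg hterm hs.summable, hs.tsum_eq]
      apply ENNReal.ofReal_le_ofReal
      have := Complex.re_le_norm (f r - f 0)
      linarith [norm_nonneg (f r - f 0)]
    calc _ = (∑' n, ENNReal.ofReal (a (n + 1) * r ^ (n + 1))) *
          ENNReal.ofReal (Real.log (2 / (1 - r)) ^ α) := by
          rw [← ENNReal.tsum_mul_right]
          refine tsum_congr fun n => ?_
          rw [ENNReal.ofReal_mul (by positivity), ENNReal.ofReal_mul (h0 _), mul_assoc]
      _ ≤ (ENNReal.ofReal r *
          ∫⁻ θ in Set.Ioo (-Real.pi) Real.pi, ENNReal.ofReal ‖deriv f (circleMap 0 r θ)‖) *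
          ENNReal.ofReal (Real.log (2 / (1 - r)) ^ α) := by gcongr
      _ = _ := by ring
  have hmeas : ∀ n : ℕ, Measurable fun r : ℝ =>
      ENNReal.ofReal (r ^ (n + 1) * Real.log (2 / (1 - r)) ^ α) := fun n => by fun_prop
  have hweight : ∀ n, ENNReal.ofReal (logWeight α n) ≤ ENNReal.ofReal (8 * 3 ^ |α|) *
      ∫⁻ r in Set.Ioo (0 : ℝ) 1, ENNReal.ofReal (r ^ n * Real.log (2 / (1 - r)) ^ α) := by
    intro n
    calc _ = ENNReal.ofReal (8 * 3 ^ |α|) *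
          ENNReal.ofReal ((3 ^ |α|)⁻¹ / 8 * logWeight α n) := by
          rw [← ENNReal.ofReal_mul (by positivity)]
          congr 1; field_simp
      _ ≤ _ := by gcongr; exact logWeight_le_setLIntegral α n
  have hpi : ENNReal.ofReal Real.pi ≠ 0 := by
    rw [Ne, ENNReal.ofReal_eq_zero, not_le]; exact Real.pi_pos
  rw [lintegral_diskArea_eq_polar (h := deriv f) (φ := fun r => Real.log (2 / (1 - r)) ^ α)
    (measurable_deriv f) (measurable_log_two_div_rpow α), ENNReal.ofReal_mul (by positivity),
    mul_assoc, ENNReal.mul_inv_cancel_left hpi ENNReal.ofReal_ne_top]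
  calc _ ≤ ∑' n, ENNReal.ofReal (a (n + 1)) * (ENNReal.ofReal (8 * 3 ^ |α|) *
        ∫⁻ r in Set.Ioo (0 : ℝ) 1,
          ENNReal.ofReal (r ^ (n + 1) * Real.log (2 / (1 - r)) ^ α)) := by
        gcongr with n
        exact hweight (n + 1)
    _ = ENNReal.ofReal (8 * 3 ^ |α|) * ∑' n, ENNReal.ofReal (a (n + 1)) *
        ∫⁻ r in Set.Ioo (0 : ℝ) 1,
          ENNReal.ofReal (r ^ (n + 1) * Real.log (2 / (1 - r)) ^ α) := by
        rw [← ENNReal.tsum_mul_left]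
        exact tsum_congr fun n => by ring
    _ = ENNReal.ofReal (8 * 3 ^ |α|) * ∫⁻ r in Set.Ioo (0 : ℝ) 1, ∑' n,
        ENNReal.ofReal (a (n + 1)) *
          ENNReal.ofReal (r ^ (n + 1) * Real.log (2 / (1 - r)) ^ α) := by
        rw [lintegral_tsum fun n => ((hmeas n).const_mul _).aemeasurable]
        congr 1
        exact tsum_congr fun n => (lintegral_const_mul _ (hmeas n)).symm
    _ ≤ _ := by
        exact mul_le_mul_right (setLIntegral_mono' measurableSet_Ioo hpt) _

end

theorem mainTheorem2 (α : ℝ) (hα : -1 ≤ α) :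
    ∃ C : ℝ≥0, 0 < C ∧
      ∀ (a : ℕ → ℝ), Antitone a → Tendsto a atTop (𝓝 0) →
      ∀ (f : ℂ → ℂ),
        (∀ z ∈ Metric.ball (0 : ℂ) 1, HasSum (fun n : ℕ => (a n : ℂ) * z ^ n) (f z)) →
        (f ∈ blochOneLog α ↔ Summable (logTerm α a)) ∧
        logSum α a / C ≤ blochOneLogNorm α f ∧
        blochOneLogNorm α f ≤ C * logSum α a := by
  have hW := logWeight_pos α 0
  have hG : 0 < geomConst α := by have := abs_nonneg α; unfold geomConst; positivity
  -- In `A` (upper bound) and `B` (lower bound) the first summand accounts for `|f 0| = a 0` and the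
  -- second for the integral; `A + B` serves both directions.
  set A : ℝ := (logWeight α 0)⁻¹ + geomConst α with hA
  set B : ℝ := logWeight α 0 + 8 * 3 ^ |α| * Real.pi with hB
  have hA0 : 0 < A := by positivity
  have hB0 : 0 < B := by positivity
  refine ⟨(A + B).toNNReal, Real.toNNReal_pos.2 (by positivity), ?_⟩
  intro a hanti hlim f hf
  have h0 : ∀ n, 0 ≤ a n := fun n => hanti.le_of_tendsto hlim n
  have hM : ∀ n, |a n| ≤ a 0 := fun n => by
    rw [abs_of_nonneg (h0 n)]; exact hanti n.zero_le
  have hf0 : ENNReal.ofReal ‖f 0‖ = ENNReal.ofReal (a 0) := by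
    rw [apply_zero_of_hasSum hf, Complex.norm_real, Real.norm_of_nonneg (h0 0)]
  have hupper : blochOneLogNorm α f ≤ ((A + B).toNNReal : ℝ≥0∞) * logSum α a := by
    have h1 : ENNReal.ofReal (a 0) ≤ ENNReal.ofReal (logWeight α 0)⁻¹ * logSum α a := by
      calc ENNReal.ofReal (a 0) = ENNReal.ofReal (logWeight α 0)⁻¹ *
            (ENNReal.ofReal (a 0) * ENNReal.ofReal (logWeight α 0)) := by
            rw [← ENNReal.ofReal_mul (h0 0), ← ENNReal.ofReal_mul (by positivity)]
            congr 1; field_simp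
        _ ≤ _ := by
            gcongr
            rw [logSum_eq_tsum h0]
            exact ENNReal.le_tsum 0
    rw [blochOneLogNorm, hf0]
    calc _ ≤ ENNReal.ofReal (logWeight α 0)⁻¹ * logSum α a +
          ENNReal.ofReal (geomConst α) * logSum α a :=
          add_le_add h1 (lintegral_deriv_le α hα hanti hlim h0 hf)
      _ = ENNReal.ofReal A * logSum α a := by
          rw [← add_mul, ← ENNReal.ofReal_add (by positivity) hG.le]
      _ ≤ ENNReal.ofReal (A + B) * logSum α a := by gcongr; linarith
      _ = _ := rfl
  have hlower : logSum α a ≤ blochOneLogNorm α f * ((A + B).toNNReal : ℝ≥0∞) := by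
    rw [logSum_eq_tsum h0, tsum_eq_zero_add' ENNReal.summable, mul_comm (blochOneLogNorm α f)]
    calc _ ≤ blochOneLogNorm α f * ENNReal.ofReal (logWeight α 0) +
          ENNReal.ofReal (8 * 3 ^ |α| * Real.pi) * blochOneLogNorm α f := by
          refine add_le_add ?_ ?_
          · gcongr
            rw [blochOneLogNorm, hf0]
            exact le_self_add
          · refine (tsum_logWeight_le_lintegral_deriv α hanti h0 hf).trans ?_
            gcongr
            exact le_add_self
      _ = ENNReal.ofReal B * blochOneLogNorm α f := by
          rw [hB, ENNReal.ofReal_add hW.le (by positivity)]; ring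
      _ ≤ ENNReal.ofReal (A + B) * blochOneLogNorm α f := by gcongr; linarith
      _ = _ := rfl
  refine ⟨?_, ENNReal.div_le_of_le_mul hlower, hupper⟩
  rw [← logSum_lt_top_iff h0]
  constructor
  · exact fun h => hlower.trans_lt (ENNReal.mul_lt_top h.2 ENNReal.coe_lt_top)
  · exact fun h => ⟨(differentiableOn_and_hasSum_deriv hM hf).1,
      hupper.trans_lt (ENNReal.mul_lt_top ENNReal.coe_lt_top h)⟩
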